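/- Let $d,N\ge 0$ be integers and $t>0$. Let $d\gamma(x)=\pi^{-d/2}e^{-|x|^2}\,dx$ on $\mathbb R^d$, and let $L=\tfrac12\Delta-\langle x,\nabla\rangle$ be the Ornstein–Uhlenbeck operator on $L^2(\mathbb R^d,d\gamma)$ (real or complex functions), whose domain consists of all $u\in L^2(\gamma)$ for which $\tfrac12\Delta u-\langle x,\nabla u\rangle$, taken in the weak sense, belongs to $L^2(\gamma)$. Then $L$ generates a strongly continuous semigroup $(e^{tL})_{t\ge0}$ on $L^2(\gamma)$, and $L^Ne^{tL}$ is everywhere defined and is an integral operator: for every $u\in L^2(\gamma)$ and almost every $x$, $$L^Ne^{tL}u(x)=\int_{\mathbb R^d}M_t^N(x,y)\,u(y)\,d\gamma(y)$$ with an absolutely convergent integral, where $$M_t^N(x,y)=M_t(x,y)\sum_{|n|=N}\binom{N}{n_1,\dots,n_d}\prod_{i=1}^d\sum_{m_i=0}^{n_i}\sum_{\ell_i=0}^{m_i}(-1)^{n_i+m_i+\ell_i}\,2^{-m_i}\genfrac\{\}{0pt}{}{n_i}{m_i}\binom{m_i}{\ell_i}\Bigl(-\frac{e^{-t}}{\sqrt{1-e^{-2t}}}\Bigr)^{2m_i-\ell_i}H_{\ell_i}(x_i)\,H_{2m_i-\ell_i}\Bigl(\frac{x_ie^{-t}-y_i}{\sqrt{1-e^{-2t}}}\Bigr).$$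 Here the outer sum runs over all multi-indices $n=(n_1,\dots,n_d)$ of non-negative integers with $n_1+\dots+n_d=N$, $\genfrac\{\}{0pt}{}{n}{m}$ are the Stirling numbers of the second kind, $H_k(x)=(-1)^ke^{x^2}\frac{d^k}{dx^k}e^{-x^2}$ are the Hermite polynomials, and $$M_t(x,y)=\frac{1}{(1-e^{-2t})^{d/2}}\exp\Bigl(-\frac{|e^{-t}x-y|^2}{1-e^{-2t}}\Bigr)e^{|y|^2}$$ is the Mehler kernel. Moreover the kernel is unique: every kernel that is measurable with respect to (the completion of) $\gamma\otimes\gamma$ and represents $L^Ne^{tL}$ in the above sense equals $M_t^N$ $\gamma\otimes\gamma$-almost everywhere. -/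

import Mathlib

open MeasureTheory Filter Topology InnerProductSpace
open scoped ContDiff NNReal

/-- The Gaussian measure `dγ(x) = π^(-d/2) exp(-|x|²) dx` on `ℝ^d`. -/
noncomputable def gaussMeasure (d : ℕ) : Measure (EuclideanSpace ℝ (Fin d)) :=
  volume.withDensity fun x =>
    ENNReal.ofReal (Real.pi ^ (-(d : ℝ) / 2) * Real.exp (-‖x‖ ^ 2))

instance gaussMeasure_isLocallyFiniteMeasure (d : ℕ) :
    IsLocallyFiniteMeasure (gaussMeasure d) := by
  unfold gaussMeasure
  refine IsLocallyFiniteMeasure.withDensity_ofReal ?_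
  fun_prop

/-- The Hilbert space `L²(ℝ^d, dγ)` of real (`𝕜 = ℝ`) or complex (`𝕜 = ℂ`) functions. -/
abbrev GaussL2 (𝕜 : Type*) [RCLike 𝕜] (d : ℕ) : Type _ :=
  Lp 𝕜 2 (gaussMeasure d)

/-- The Ornstein-Uhlenbeck differential expression `½ Δφ - ⟨x, ∇φ⟩`. -/
noncomputable def ouExpr {d : ℕ} (φ : EuclideanSpace ℝ (Fin d) → ℝ)
    (x : EuclideanSpace ℝ (Fin d)) : ℝ :=
  1 / 2 * Laplacian.laplacian φ x - inner ℝ x (gradient φ x)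

lemma ouExpr_continuous {d : ℕ} {φ : EuclideanSpace ℝ (Fin d) → ℝ} (hφ : ContDiff ℝ ∞ φ) :
    Continuous (ouExpr φ) := by
  have h1 : Continuous (Laplacian.laplacian φ) := by
    rw [laplacian_eq_iteratedFDeriv_stdOrthonormalBasis]
    refine continuous_finsetSum _ fun i _ => ?_
    have h := (contDiff_infty.mp hφ 2).continuous_iteratedFDeriv (m := 2) le_rfl
    exact (ContinuousMultilinearMap.apply ℝ (fun _ : Fin 2 => EuclideanSpace ℝ (Fin d)) ℝ
      _).continuous.comp h
  have h2 : Continuous (gradient φ) := by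
    have h := hφ.continuous_fderiv (by simp)
    exact (toDual ℝ (EuclideanSpace ℝ (Fin d))).symm.continuous.comp h
  unfold ouExpr
  fun_prop

lemma ouExpr_hasCompactSupport {d : ℕ} {φ : EuclideanSpace ℝ (Fin d) → ℝ}
    (hφ : HasCompactSupport φ) : HasCompactSupport (ouExpr φ) := by
  refine HasCompactSupport.intro' hφ (isClosed_tsupport φ) fun x hx => ?_
  have h0 : φ =ᶠ[𝓝 x] fun _ => 0 := notMem_tsupport_iff_eventuallyEq.mp hx
  have h1 : Laplacian.laplacian φ x = 0 := by
    rw [(laplacian_congr_nhds h0).eq_of_nhds]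
    simp
  have h2 : gradient φ x = 0 := by
    rw [h0.gradient_eq]
    exact gradient_fun_const x 0
  simp [ouExpr, h1, h2]

lemma GaussL2.integrable_smul {𝕜 : Type*} [RCLike 𝕜] {d : ℕ} (u : GaussL2 𝕜 d)
    {ψ : EuclideanSpace ℝ (Fin d) → ℝ} (hψ : Continuous ψ) (hc : HasCompactSupport ψ) :
    Integrable (fun x => ψ x • u x) (gaussMeasure d) :=
  ((Lp.memLp u).locallyIntegrable (by norm_num)).integrable_smul_left_of_hasCompactSupport hψ hc

/-- The graph of the Ornstein-Uhlenbeck operator: all pairs `(u, f)` of functions in `L²(γ)` such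
that `½ Δu - ⟨x, ∇u⟩ = f` weakly, i.e. `∫ u (½ Δφ - ⟨x, ∇φ⟩) dγ = ∫ f φ dγ` for all test functions
`φ ∈ C_c^∞(ℝ^d)`.  (The expression is formally symmetric with respect to `γ`, so after replacing
`φ` by `φ` times the Gaussian density this is the equation in the sense of distributions.) -/
noncomputable def ouGraph (𝕜 : Type*) [RCLike 𝕜] (d : ℕ) :
    Submodule 𝕜 (GaussL2 𝕜 d × GaussL2 𝕜 d) where
  carrier := {p | ∀ φ : EuclideanSpace ℝ (Fin d) → ℝ, ContDiff ℝ ∞ φ → HasCompactSupport φ →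
    ∫ x, ouExpr φ x • p.1 x ∂(gaussMeasure d) = ∫ x, φ x • p.2 x ∂(gaussMeasure d)}
  zero_mem' := by
    intro φ _ _
    have key : ∀ (ψ : EuclideanSpace ℝ (Fin d) → ℝ),
        ∫ x, ψ x • (0 : GaussL2 𝕜 d) x ∂(gaussMeasure d) = 0 := by
      intro ψ
      refine integral_eq_zero_of_ae ?_
      filter_upwards [Lp.coeFn_zero 𝕜 2 (gaussMeasure d)] with x hx
      rw [hx, Pi.zero_apply, smul_zero]
    rw [Prod.fst_zero, Prod.snd_zero, key, key]
  add_mem' := by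
    intro p q hp hq φ hφ hc
    have key : ∀ (ψ : EuclideanSpace ℝ (Fin d) → ℝ), Continuous ψ → HasCompactSupport ψ →
        ∀ u v : GaussL2 𝕜 d, ∫ x, ψ x • (u + v : GaussL2 𝕜 d) x ∂(gaussMeasure d)
          = ∫ x, ψ x • u x ∂(gaussMeasure d) + ∫ x, ψ x • v x ∂(gaussMeasure d) := by
      intro ψ h1 h2 u v
      rw [← integral_add (u.integrable_smul h1 h2) (v.integrable_smul h1 h2)]
      refine integral_congr_ae ?_
      filter_upwards [Lp.coeFn_add u v] with x hx
      rw [hx, Pi.add_apply, smul_add]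
    rw [Prod.fst_add, Prod.snd_add,
      key _ (ouExpr_continuous hφ) (ouExpr_hasCompactSupport hc), key _ hφ.continuous hc,
      hp φ hφ hc, hq φ hφ hc]
  smul_mem' := by
    intro c p hp φ hφ hc
    have key : ∀ (ψ : EuclideanSpace ℝ (Fin d) → ℝ),
        ∀ u : GaussL2 𝕜 d, ∫ x, ψ x • (c • u : GaussL2 𝕜 d) x ∂(gaussMeasure d)
          = c • ∫ x, ψ x • u x ∂(gaussMeasure d) := by
      intro ψ u
      rw [← integral_smul]
      refine integral_congr_ae ?_
      filter_upwards [Lp.coeFn_smul c u] with x hx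
      rw [hx, Pi.smul_apply, smul_comm]
    rw [Prod.smul_fst, Prod.smul_snd, key, key, hp φ hφ hc]

/-- The Ornstein-Uhlenbeck operator `L = ½ Δ - ⟨x, ∇⟩` as an unbounded operator in `L²(ℝ^d, dγ)`:
its domain consists of all `u ∈ L²(γ)` for which `½ Δu - ⟨x, ∇u⟩`, taken weakly, is in `L²(γ)`. -/
noncomputable def ouOperator (𝕜 : Type*) [RCLike 𝕜] (d : ℕ) : GaussL2 𝕜 d →ₗ.[𝕜] GaussL2 𝕜 d :=
  (ouGraph 𝕜 d).toLinearPMap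

/-- The graph is single-valued, so `ouOperator` has exactly the graph `ouGraph`. -/
lemma ouOperator_graph (𝕜 : Type*) [RCLike 𝕜] (d : ℕ) :
    (ouOperator 𝕜 d).graph = ouGraph 𝕜 d := by
  refine Submodule.toLinearPMap_graph_eq _ ?_
  rintro ⟨u, f⟩ h hu
  simp only at hu
  subst hu
  have hz : ∀ᵐ x ∂(gaussMeasure d), f x = 0 := by
    refine ae_eq_zero_of_integral_contDiff_smul_eq_zero
      ((Lp.memLp f).locallyIntegrable (by norm_num)) fun φ hφ hc => ?_
    rw [← h φ hφ hc]
    refine integral_eq_zero_of_ae ?_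
    filter_upwards [Lp.coeFn_zero 𝕜 2 (gaussMeasure d)] with x hx
    rw [hx, Pi.zero_apply, smul_zero]
  exact (Lp.eq_zero_iff_ae_eq_zero).mpr hz

section Semigroups

variable {𝕜 : Type*} [RCLike 𝕜] {H : Type*} [NormedAddCommGroup H] [NormedSpace 𝕜 H]

/-- `S` is a strongly continuous (`C₀`-) semigroup of bounded operators. -/
structure IsC0Semigroup (S : ℝ≥0 → H →L[𝕜] H) : Prop where
  map_zero : S 0 = ContinuousLinearMap.id 𝕜 H
  map_add : ∀ s t : ℝ≥0, S (s + t) = (S s).comp (S t)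
  tendsto_zero : ∀ u : H, Tendsto (fun t => S t u) (𝓝 0) (𝓝 u)

/-- `A` is the infinitesimal generator of `S`: one has `u ∈ D(A)` and `A u = f` if and only if
`(S t u - u) / t → f` as `t ↓ 0`. -/
def IsGenerator (A : H →ₗ.[𝕜] H) (S : ℝ≥0 → H →L[𝕜] H) : Prop :=
  ∀ u f : H, (u, f) ∈ A.graph ↔
    Tendsto (fun t : ℝ≥0 => (((t : ℝ)⁻¹ : ℝ) : 𝕜) • (S t u - u)) (𝓝[>] 0) (𝓝 f)

open scoped Classical in
/-- The semigroup `e^{tA}` generated by an unbounded operator `A` (a `C₀`-semigroup is determined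
by its generator).  If `A` generates no `C₀`-semigroup the value is the junk value `0`. -/
noncomputable def expSemigroup (A : H →ₗ.[𝕜] H) : ℝ≥0 → H →L[𝕜] H :=
  if h : ∃ S : ℝ≥0 → H →L[𝕜] H, IsC0Semigroup S ∧ IsGenerator A S then h.choose else 0

/-- `OperatorPowEq A N u f` means that `u ∈ D(A^N)` and `A^N u = f`. -/
def OperatorPowEq (A : H →ₗ.[𝕜] H) : ℕ → H → H → Prop
  | 0, u, f => f = u
  | N + 1, u, f => ∃ v, OperatorPowEq A N u v ∧ (v, f) ∈ A.graph

end Semigroups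

/-- `K` is an integral kernel with respect to `γ` of the operator on `L²(γ)` with graph `R`:
`K` is measurable on the product, and every `u ∈ L²(γ)` is in the domain of the operator and is
mapped to the function `x ↦ ∫ K(x, y) u(y) dγ(y)`, the integral converging absolutely for almost
every `x`. -/
def IsIntegralKernel {𝕜 : Type*} [RCLike 𝕜] {d : ℕ} (R : GaussL2 𝕜 d → GaussL2 𝕜 d → Prop)
    (K : EuclideanSpace ℝ (Fin d) → EuclideanSpace ℝ (Fin d) → 𝕜) : Prop :=
  AEStronglyMeasurable (Function.uncurry K) ((gaussMeasure d).prod (gaussMeasure d)) ∧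
  ∀ u : GaussL2 𝕜 d, ∃ f : GaussL2 𝕜 d, R u f ∧ ∀ᵐ x ∂(gaussMeasure d),
    Integrable (fun y => K x y * u y) (gaussMeasure d) ∧
    f x = ∫ y, K x y * u y ∂(gaussMeasure d)

/-- The Mehler kernel
`M_t(x, y) = exp(-|e^{-t} x - y|² / (1 - e^{-2t})) / (1 - e^{-2t})^{d/2} * exp(|y|²)`. -/
noncomputable def mehlerKernel {d : ℕ} (t : ℝ) (x y : EuclideanSpace ℝ (Fin d)) : ℝ :=
  Real.exp (-(‖Real.exp (-t) • x - y‖ ^ 2 / (1 - Real.exp (-2 * t)))) /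
    (1 - Real.exp (-2 * t)) ^ ((d : ℝ) / 2) * Real.exp (‖y‖ ^ 2)

/-- The Hermite polynomials, by Rodrigues's formula `H_n(x) = (-1)^n e^{x²} ∂_x^n e^{-x²}`. -/
noncomputable def hermiteH (n : ℕ) (x : ℝ) : ℝ :=
  (-1) ^ n * Real.exp (x ^ 2) * iteratedDeriv n (fun y => Real.exp (-y ^ 2)) x

/-- The closed-form kernel: the Mehler kernel times the sum over all multi-indices `n` with
`|n| = N` of multinomial coefficients times products over the coordinates. -/
noncomputable def ouKernel {d : ℕ} (N : ℕ) (t : ℝ) (x y : EuclideanSpace ℝ (Fin d)) : ℝ :=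
  mehlerKernel t x y *
    ∑ n ∈ Finset.piAntidiag (Finset.univ : Finset (Fin d)) N,
      (Nat.multinomial Finset.univ n : ℝ) *
        ∏ i, ∑ m ∈ Finset.range (n i + 1), ∑ l ∈ Finset.range (m + 1),
          (-1 : ℝ) ^ (n i + m + l) * ((2 : ℝ) ^ m)⁻¹ *
            (Nat.stirlingSecond (n i) m : ℝ) * (Nat.choose m l : ℝ) *
            (-(Real.exp (-t) / Real.sqrt (1 - Real.exp (-2 * t)))) ^ (2 * m - l) *
            hermiteH l (x i) *
            hermiteH (2 * m - l)
              ((x i * Real.exp (-t) - y i) / Real.sqrt (1 - Real.exp (-2 * t)))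

/-! The proof identifies `e^{tL}` with the integral operator of the Mehler kernel and then lets `L`
act on that kernel in the variable `x`.

The identification rests on the functions `cos (⟨ξ, x⟩ + a)`. An element of `L²(γ)` is determined by
its pairings with them, and the Mehler operator maps the function of frequency `ξ` to `exp (-(1 -
e^{-2t})|ξ|²/4)` times the one of frequency `e^{-t} ξ` (`integral_mehlerKernel_mul_trigFun`). The
semigroup law follows directly; strong continuity follows with the contractivity given by the Schur
test. The weak equation `Lu = f` may be tested with these functions, by a cutoff argument
(`integral_ouExpr_smul_eq_of_mem_ouGraph`), and differentiating in time gives the Duhamel formula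
`mehlerSemigroup_sub_eq_integral`. Hence the maximal weak domain lies in the domain of the
generator; the converse inclusion comes from the symmetry of the kernel. Since a semigroup is
determined by its generator, `e^{tL}` is the Mehler semigroup (`expSemigroup_ouOperator`).

For the closed form, write the one-dimensional operator as `-½ δ∂` with `δ = 2x - ∂`. From `[∂, δ] =
2` its `n`-th power is `(-1)^n ∑ 2^{-m} S(n,m) δ^m ∂^m` with Stirling numbers `S(n,m)`. As `δ =
-e^{x²} ∂ e^{-x²}`, the Leibniz rule produces the Hermite polynomials. In `d` variables the
coordinate operators act on separate factors of a product of Gaussians, so the multinomial theorem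
gives the outer sum and `L_x M_t^N = M_t^{N+1}` (`ouExpr_ouKernel`). All these kernels are square
integrable for `γ ⊗ γ`, so Fubini and the symmetry of `L` turn this identity into one between
operators.

Uniqueness of the kernel again uses the trigonometric functions: countably many of them suffice to
determine `K(x, ·)` for almost every `x`. -/

/-! ### Integrability with respect to the Gaussian measure. -/

section GaussianMeasure

variable {d : ℕ}

/-- The density of the Gaussian measure with respect to Lebesgue measure. -/
noncomputable def gaussDensity (x : EuclideanSpace ℝ (Fin d)) : ℝ :=
  Real.pi ^ (-(d : ℝ) / 2) * Real.exp (-‖x‖ ^ 2)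

lemma gaussDensity_pos (x : EuclideanSpace ℝ (Fin d)) : 0 < gaussDensity x := by
  unfold gaussDensity; positivity

lemma gaussDensity_contDiff {n : WithTop ℕ∞} :
    ContDiff ℝ n (gaussDensity : EuclideanSpace ℝ (Fin d) → ℝ) := by
  unfold gaussDensity
  exact contDiff_const.mul (Real.contDiff_exp.comp (contDiff_norm_sq ℝ).neg)

lemma gaussDensity_continuous : Continuous (gaussDensity : EuclideanSpace ℝ (Fin d) → ℝ) := by
  unfold gaussDensity; fun_prop

variable {F : Type*} [NormedAddCommGroup F] [NormedSpace ℝ F]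

lemma integral_gaussMeasure (f : EuclideanSpace ℝ (Fin d) → F) :
    ∫ x, f x ∂(gaussMeasure d) = ∫ x, gaussDensity x • f x := by
  have h : Measurable fun x : EuclideanSpace ℝ (Fin d) => ENNReal.ofReal (gaussDensity x) :=
    gaussDensity_continuous.measurable.ennreal_ofReal
  have := integral_withDensity_eq_integral_toReal_smul (μ := volume) h
    (Eventually.of_forall fun x => ENNReal.ofReal_lt_top) f
  simp only [ENNReal.toReal_ofReal (gaussDensity_pos _).le] at this
  exact this

lemma integrable_gaussMeasure_iff {f : EuclideanSpace ℝ (Fin d) → F} :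
    Integrable f (gaussMeasure d) ↔ Integrable (fun x => gaussDensity x • f x) := by
  have h : Measurable fun x : EuclideanSpace ℝ (Fin d) => ENNReal.ofReal (gaussDensity x) :=
    gaussDensity_continuous.measurable.ennreal_ofReal
  have := integrable_withDensity_iff_integrable_smul' (μ := volume) h
    (Eventually.of_forall fun x => ENNReal.ofReal_lt_top) (g := f)
  simp only [ENNReal.toReal_ofReal (gaussDensity_pos _).le] at this
  exact this

lemma integrable_exp_neg_mul_norm_sq {b : ℝ} (hb : 0 < b) :
    Integrable fun x : EuclideanSpace ℝ (Fin d) => Real.exp (-b * ‖x‖ ^ 2) := by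
  have h := (GaussianFourier.integrable_cexp_neg_mul_sq_norm_add (V := EuclideanSpace ℝ (Fin d))
    (b := (b : ℂ)) (by simpa using hb) 0 0).norm
  refine h.congr (Eventually.of_forall fun x => ?_)
  simp [Complex.norm_exp, ← Complex.ofReal_pow]

lemma integrable_exp_mul_norm_sq_gaussMeasure {c : ℝ} (hc : c < 1) :
    Integrable (fun x => Real.exp (c * ‖x‖ ^ 2)) (gaussMeasure d) := by
  rw [integrable_gaussMeasure_iff]
  refine ((integrable_exp_neg_mul_norm_sq (b := 1 - c) (by linarith)).const_mul
    (Real.pi ^ (-(d : ℝ) / 2))).congr (Eventually.of_forall fun x => ?_)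
  simp only [gaussDensity, smul_eq_mul, mul_assoc, ← Real.exp_add]
  ring_nf

instance gaussMeasure_isFiniteMeasure (d : ℕ) : IsFiniteMeasure (gaussMeasure d) := by
  have h := integrable_exp_mul_norm_sq_gaussMeasure (d := d) (c := 0) zero_lt_one
  simp only [zero_mul, Real.exp_zero] at h
  exact (integrable_const_iff_isFiniteMeasure one_ne_zero).mp h

/-- This is `r ≤ 1 + r²/4`, that is `(r/2 - 1)² ≥ 0`. The exponent 1/4 is chosen so that the square
is still integrable against `γ`. -/
lemma norm_le_exp_norm_sq {V : Type*} [NormedAddCommGroup V] (x : V) :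
    ‖x‖ ≤ Real.exp (‖x‖ ^ 2 / 4) := by
  nlinarith [Real.add_one_le_exp (‖x‖ ^ 2 / 4), sq_nonneg (‖x‖ / 2 - 1)]

lemma memLp_norm_gaussMeasure :
    MemLp (fun x : EuclideanSpace ℝ (Fin d) => ‖x‖) 2 (gaussMeasure d) := by
  rw [memLp_two_iff_integrable_sq (by fun_prop)]
  refine (integrable_exp_mul_norm_sq_gaussMeasure (c := 1 / 2) (by norm_num)).mono'
    (by fun_prop) (Eventually.of_forall fun x => ?_)
  rw [Real.norm_of_nonneg (by positivity)]
  calc ‖x‖ ^ 2 ≤ (Real.exp (‖x‖ ^ 2 / 4)) ^ 2 := by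
        gcongr; exact norm_le_exp_norm_sq x
    _ = _ := by rw [← Real.exp_nat_mul]; ring_nf

end GaussianMeasure

/-! ### Trigonometric functions as a separating family. -/

section TrigFamily

variable {V : Type*} [NormedAddCommGroup V] [InnerProductSpace ℝ V]

/-- The trigonometric function `x ↦ cos (⟨ξ, x⟩ + a)`. -/
noncomputable def trigFun (ξ : V) (a : ℝ) (x : V) : ℝ := Real.cos (inner ℝ ξ x + a)

lemma abs_trigFun_le (ξ : V) (a : ℝ) (x : V) : |trigFun ξ a x| ≤ 1 := Real.abs_cos_le_one _

lemma trigFun_continuous (ξ : V) (a : ℝ) : Continuous (trigFun ξ a) := by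
  unfold trigFun; fun_prop

variable [MeasurableSpace V] [BorelSpace V] {μ : Measure V} {𝕜 : Type*} [RCLike 𝕜]

lemma integrable_trigFun_smul {g : V → 𝕜} (hg : Integrable g μ) (ξ : V) (a : ℝ) :
    Integrable (fun x => trigFun ξ a x • g x) μ :=
  hg.bdd_smul 1 (trigFun_continuous ξ a).measurable.aestronglyMeasurable
    (Eventually.of_forall fun x => abs_trigFun_le ξ a x)

lemma continuous_integral_trigFun_smul {g : V → 𝕜} (hg : Integrable g μ) :
    Continuous fun p : V × ℝ => ∫ x, trigFun p.1 p.2 x • g x ∂μ := by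
  refine continuous_of_dominated (bound := fun x => ‖g x‖)
    (fun p => (integrable_trigFun_smul hg _ _).aestronglyMeasurable)
    (fun p => Eventually.of_forall fun x => ?_) hg.norm (Eventually.of_forall fun x => ?_)
  · rw [norm_smul]
    exact mul_le_of_le_one_left (norm_nonneg _) (abs_trigFun_le _ _ _)
  · unfold trigFun; fun_prop

variable [SecondCountableTopology V]

/-- The phases `0` and `-π/2` give cosine and sine, so the Fourier transform of `g μ` vanishes.
Hence the finite measures with densities `g⁺` and `g⁻` have the same characteristic function and
coincide, which forces `g⁺ = g⁻`, so both are zero. -/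
lemma ae_eq_zero_of_integral_trigFun_mul_eq_zero [CompleteSpace V] {g : V → ℝ}
    (hg : Integrable g μ) (h : ∀ ξ a, ∫ x, trigFun ξ a x * g x ∂μ = 0) : g =ᵐ[μ] 0 := by
  have key : ∀ ξ, ∫ x, Complex.exp (inner ℝ x ξ * Complex.I) * (g x : ℂ) ∂μ = 0 := by
    intro ξ
    have e : ∀ x, Complex.exp (inner ℝ x ξ * Complex.I) * (g x : ℂ)
        = ((trigFun ξ 0 x * g x : ℝ) : ℂ)
          + ((trigFun ξ (-(Real.pi / 2)) x * g x : ℝ) : ℂ) * Complex.I := by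
      intro x
      rw [Complex.exp_mul_I]
      simp only [trigFun, add_zero, ← sub_eq_add_neg, Real.cos_sub_pi_div_two,
        real_inner_comm x ξ]
      push_cast
      ring
    have h0 := integrable_trigFun_smul hg ξ 0
    have h1 := integrable_trigFun_smul hg ξ (-(Real.pi / 2))
    simp only [smul_eq_mul] at h0 h1
    simp only [e]
    rw [integral_add h0.ofReal (h1.ofReal.mul_const _), integral_mul_const, integral_complex_ofReal,
      integral_complex_ofReal, h, h]
    simp
  have hm : ∀ f : V → ℝ, Integrable f μ → IsFiniteMeasure
      (μ.withDensity fun x => ENNReal.ofReal (f x)) := fun f hf =>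
    isFiniteMeasure_withDensity_ofReal hf.2
  have := hm g hg
  have := hm _ hg.neg
  have hc : ∀ f : V → ℝ, Integrable f μ → ∀ ξ,
      charFun (μ.withDensity fun x => ENNReal.ofReal (f x)) ξ
        = ∫ x, Complex.exp (inner ℝ x ξ * Complex.I) * ((max (f x) 0 : ℝ) : ℂ) ∂μ := by
    intro f hf ξ
    rw [charFun_apply, integral_withDensity_eq_integral_toReal_smul₀
      hf.1.aemeasurable.ennreal_ofReal (Eventually.of_forall fun _ => ENNReal.ofReal_lt_top)]
    refine integral_congr_ae (Eventually.of_forall fun x => ?_)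
    simp only [ENNReal.toReal_ofReal', Complex.real_smul, mul_comm]
  have hint' : ∀ f : V → ℝ, Integrable f μ → ∀ ξ,
      Integrable (fun x => Complex.exp (inner ℝ x ξ * Complex.I) * ((max (f x) 0 : ℝ) : ℂ)) μ :=
    fun f hf ξ => hf.pos_part.ofReal.bdd_mul (c := 1) (by fun_prop)
      (Eventually.of_forall fun x => (Complex.norm_exp_ofReal_mul_I _).le)
  have heq : (μ.withDensity fun x => ENNReal.ofReal (g x))
      = μ.withDensity fun x => ENNReal.ofReal ((-g) x) := by
    refine Measure.ext_of_charFun (funext fun ξ => ?_)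
    rw [hc g hg, hc _ hg.neg, ← sub_eq_zero, ← integral_sub (hint' g hg ξ) (hint' _ hg.neg ξ),
      ← key ξ]
    refine integral_congr_ae (Eventually.of_forall fun x => ?_)
    simp only [← mul_sub, ← Complex.ofReal_sub, Pi.neg_apply]
    congr 2
    rcases le_total (g x) 0 with h0 | h0
    · rw [max_eq_right h0, max_eq_left (by linarith)]; ring
    · rw [max_eq_left h0, max_eq_right (by linarith)]; ring
  have := (withDensity_eq_iff hg.1.aemeasurable.ennreal_ofReal
    hg.neg.1.aemeasurable.ennreal_ofReal hg.lintegral_lt_top.ne).mp heq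
  filter_upwards [this] with x hx
  rcases lt_trichotomy (g x) 0 with h0 | h0 | h0
  · rw [ENNReal.ofReal_of_nonpos h0.le] at hx
    simp only [Pi.neg_apply] at hx
    have := ENNReal.ofReal_eq_zero.mp hx.symm
    simp only [Pi.zero_apply]; linarith
  · exact h0
  · rw [Pi.neg_apply, ENNReal.ofReal_of_nonpos (p := -g x) (by linarith)] at hx
    have := ENNReal.ofReal_eq_zero.mp hx
    simp only [Pi.zero_apply]; linarith

/-- An integrable function is determined by its integrals against the trigonometric functions. -/
lemma ae_eq_zero_of_integral_trigFun_smul_eq_zero [CompleteSpace V] {g : V → 𝕜}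
    (hg : Integrable g μ) (h : ∀ ξ a, ∫ x, trigFun ξ a x • g x ∂μ = 0) : g =ᵐ[μ] 0 := by
  have hre : (fun x => RCLike.re (g x)) =ᵐ[μ] 0 := by
    refine ae_eq_zero_of_integral_trigFun_mul_eq_zero hg.re fun ξ a => ?_
    have := congrArg RCLike.re (h ξ a)
    rw [← integral_re (integrable_trigFun_smul hg ξ a)] at this
    simpa [RCLike.smul_re] using this
  have him : (fun x => RCLike.im (g x)) =ᵐ[μ] 0 := by
    refine ae_eq_zero_of_integral_trigFun_mul_eq_zero hg.im fun ξ a => ?_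
    have := congrArg RCLike.im (h ξ a)
    rw [← integral_im (integrable_trigFun_smul hg ξ a)] at this
    simpa [RCLike.smul_im] using this
  filter_upwards [hre, him] with x h1 h2
  exact RCLike.ext (by simpa using h1) (by simpa using h2)

end TrigFamily

/-! ### Strongly continuous semigroups and uniqueness for a given generator. -/

section C0Semigroups

variable {𝕜 : Type*} [RCLike 𝕜] {H : Type*} [NormedAddCommGroup H] [NormedSpace 𝕜 H]
  {S T : ℝ≥0 → H →L[𝕜] H} {A : H →ₗ.[𝕜] H}

namespace IsC0Semigroup

lemma apply_add (hS : IsC0Semigroup S) (s t : ℝ≥0) (u : H) : S (s + t) u = S s (S t u) := by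
  rw [hS.map_add]; rfl

lemma apply_comm (hS : IsC0Semigroup S) (s t : ℝ≥0) (u : H) : S s (S t u) = S t (S s u) := by
  rw [← hS.apply_add, ← hS.apply_add, add_comm]

/-- Otherwise there are `t n → 0` with `‖S (t n)‖ > n`, although every orbit `S (t n) u` converges;
this contradicts the uniform boundedness principle. -/
lemma exists_norm_le_near_zero [CompleteSpace H] (hS : IsC0Semigroup S) :
    ∃ δ > 0, ∃ C, ∀ t ≤ δ, ‖S t‖ ≤ C := by
  by_contra! hcon
  have h1 : ∀ n : ℕ, ∃ t : ℝ≥0, t ≤ 1 / (n + 1) ∧ (n : ℝ) < ‖S t‖ := fun n =>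
    hcon (1 / (n + 1)) (by positivity) n
  choose t ht hn using h1
  have ht0 : Tendsto t atTop (𝓝 0) :=
    tendsto_of_tendsto_of_tendsto_of_le_of_le tendsto_const_nhds
      tendsto_one_div_add_atTop_nhds_zero_nat (fun _ => zero_le) ht
  obtain ⟨C, hC⟩ := banach_steinhaus (g := fun n => S (t n)) fun u => by
    obtain ⟨C, hC⟩ := (((hS.tendsto_zero u).comp ht0).norm).bddAbove_range
    exact ⟨C, fun n => hC ⟨n, rfl⟩⟩
  obtain ⟨n, hnC⟩ := exists_nat_gt C
  exact absurd (hC n) (not_le.mpr (hnC.trans (hn n)))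

lemma exists_norm_le [CompleteSpace H] (hS : IsC0Semigroup S) (b : ℝ≥0) :
    ∃ C, ∀ t ≤ b, ‖S t‖ ≤ C := by
  obtain ⟨δ, hδ, C, hC⟩ := hS.exists_norm_le_near_zero
  have key : ∀ n : ℕ, ∃ C', ∀ t ≤ n • δ, ‖S t‖ ≤ C' := by
    intro n
    induction n with
    | zero => exact ⟨C, fun t ht => hC t (ht.trans (by simp))⟩
    | succ n ih =>
      obtain ⟨C', hC'⟩ := ih
      refine ⟨max C (‖S δ‖ * C'), fun t ht => ?_⟩
      rcases le_total t δ with h | h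
      · exact (hC t h).trans (le_max_left _ _)
      · have e : t = δ + (t - δ) := (add_tsub_cancel_of_le h).symm
        have h2 : t - δ ≤ n • δ := by
          rw [tsub_le_iff_right, ← succ_nsmul]; exact ht
        rw [e, hS.map_add]
        refine ((ContinuousLinearMap.opNorm_comp_le _ _).trans ?_).trans (le_max_right _ _)
        gcongr
        exact hC' _ h2
  obtain ⟨n, hn⟩ := Archimedean.arch b hδ
  obtain ⟨C', hC'⟩ := key n
  exact ⟨C', fun t ht => hC' t (ht.trans hn)⟩

lemma continuous_apply [CompleteSpace H] (hS : IsC0Semigroup S) (u : H) :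
    Continuous fun t => S t u := by
  rw [continuous_iff_continuousAt]
  intro t₀
  obtain ⟨C, hC⟩ := hS.exists_norm_le (t₀ + 1)
  -- Subtraction in `ℝ≥0` is truncated, so this sum is `|t - t₀|`; it treats both one-sided limits
  -- at once.
  have hlim : Tendsto (fun t : ℝ≥0 => (t - t₀) + (t₀ - t)) (𝓝 t₀) (𝓝 0) := by
    have : Continuous fun t : ℝ≥0 => (t - t₀) + (t₀ - t) := by fun_prop
    simpa using this.tendsto t₀
  have h1 : Tendsto (fun t : ℝ≥0 => C * ‖S ((t - t₀) + (t₀ - t)) u - u‖) (𝓝 t₀) (𝓝 0) := by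
    have := (((hS.tendsto_zero u).comp hlim).sub_const u).norm.const_mul C
    simpa using this
  rw [ContinuousAt, tendsto_iff_norm_sub_tendsto_zero]
  refine squeeze_zero' (Eventually.of_forall fun _ => norm_nonneg _) ?_ h1
  filter_upwards [Iio_mem_nhds (show t₀ < t₀ + 1 from lt_add_one t₀)] with t ht
  rcases le_total t t₀ with h | h
  · rw [tsub_eq_zero_of_le h, zero_add]
    have e : S t₀ u = S t (S (t₀ - t) u) := by
      rw [← hS.apply_add, add_tsub_cancel_of_le h]
    rw [e, ← map_sub, norm_sub_rev _ u]
    exact ((S t).le_opNorm _).trans (by gcongr; exact hC t (le_of_lt ht))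
  · rw [tsub_eq_zero_of_le h, add_zero]
    have e : S t u = S t₀ (S (t - t₀) u) := by
      rw [← hS.apply_add, add_tsub_cancel_of_le h]
    rw [e, ← map_sub]
    exact ((S t₀).le_opNorm _).trans (by gcongr; exact hC t₀ (by simp))

end IsC0Semigroup

lemma IsGenerator.apply_mem_graph (hS : IsC0Semigroup S) (hA : IsGenerator A S) {u f : H}
    (h : (u, f) ∈ A.graph) (t : ℝ≥0) : (S t u, S t f) ∈ A.graph := by
  rw [hA] at h ⊢
  refine (((S t).continuous.tendsto f).comp h).congr fun s => ?_
  simp only [Function.comp, map_smul, map_sub, hS.apply_comm t s]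

/-- A `C₀`-semigroup and a contractive `C₀`-semigroup with the same densely defined generator
coincide. -/
lemma IsC0Semigroup.eq_of_isGenerator [CompleteSpace H] [NormedSpace ℝ H] [IsScalarTower ℝ 𝕜 H]
    (hS : IsC0Semigroup S) (hT : IsC0Semigroup T) (hT1 : ∀ t, ‖T t‖ ≤ 1) (hAS : IsGenerator A S)
    (hAT : IsGenerator A T) (hA : Dense {u | ∃ f, (u, f) ∈ A.graph}) : S = T := by
  have hle : ∀ t w, ‖T t w‖ ≤ ‖w‖ := fun t w =>
    ((T t).le_opNorm w).trans (mul_le_of_le_one_left (norm_nonneg _) (hT1 t))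
  have key : ∀ u f, (u, f) ∈ A.graph → ∀ t, S t u = T t u := by
    intro u f huf t
    -- The curve `v` joins `v 0 = T t u` to `v t = S t u`; it is shown to be constant.
    set v : ℝ → H := fun s => T (t - s).toNNReal (S s.toNNReal u) with hv
    have hcont : Continuous v := by
      rw [continuous_iff_continuousAt]
      intro s₀
      have h1 : Tendsto (fun s : ℝ => ‖S s.toNNReal u - S s₀.toNNReal u‖
          + ‖T (t - s).toNNReal (S s₀.toNNReal u) - v s₀‖) (𝓝 s₀) (𝓝 0) := by
        have c1 : Continuous fun s : ℝ => ‖S s.toNNReal u - S s₀.toNNReal u‖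
            + ‖T (t - s).toNNReal (S s₀.toNNReal u) - v s₀‖ := by
          have h2 := (hS.continuous_apply u).comp continuous_real_toNNReal
          have h3 := (hT.continuous_apply (S s₀.toNNReal u)).comp
            (continuous_real_toNNReal.comp (continuous_const.sub continuous_id : Continuous
              fun s : ℝ => (t : ℝ) - s))
          exact (h2.sub continuous_const).norm.add (h3.sub continuous_const).norm
        simpa [hv] using c1.tendsto s₀
      rw [ContinuousAt, tendsto_iff_norm_sub_tendsto_zero]
      refine squeeze_zero (fun _ => norm_nonneg _) (fun s => ?_) h1
      -- `T` is only strongly continuous, so its argument is frozen at `s₀` first; the error is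
      -- controlled by the contractivity of `T`.
      refine (norm_sub_le_norm_sub_add_norm_sub _ (T (t - s).toNNReal (S s₀.toNNReal u)) _).trans ?_
      gcongr
      rw [hv]
      simp only
      rw [← map_sub]
      exact hle _ _
    -- The slope of `v` is `T (t - y)` applied to the difference of the difference quotients of `S`
    -- and `T` at `w = S s u`. Both tend to `A w`, and `T` is contractive. A vanishing right
    -- derivative is enough for a continuous curve.
    have hder : ∀ s ∈ Set.Ico (0 : ℝ) t, HasDerivWithinAt v 0 (Set.Ici s) s := by
      intro s hs
      rw [hasDerivWithinAt_iff_tendsto_slope, Set.Ici_sdiff_left]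
      set w := S s.toNNReal u
      have hw := hAS.apply_mem_graph hS huf s.toNNReal
      have hD := (((hAS _ _).mp hw).sub ((hAT _ _).mp hw)).norm
      rw [sub_self, norm_zero] at hD
      have hm : Tendsto (fun y : ℝ => (y - s).toNNReal) (𝓝[>] s) (𝓝[>] 0) := by
        refine tendsto_nhdsWithin_iff.mpr ⟨?_, ?_⟩
        · have : Continuous fun y : ℝ => (y - s).toNNReal := by fun_prop
          have := (this.tendsto s).mono_left (nhdsWithin_le_nhds (s := Set.Ioi s))
          simpa using this
        · filter_upwards [self_mem_nhdsWithin] with y hy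
          exact Real.toNNReal_pos.mpr (sub_pos.mpr hy)
      refine squeeze_zero_norm' ?_ (hD.comp hm)
      filter_upwards [Ioo_mem_nhdsGT hs.2] with y hy
      have hys : 0 ≤ y - s := by linarith [hy.1]
      have e1 : y.toNNReal = (y - s).toNNReal + s.toNNReal := by
        rw [← Real.toNNReal_add hys hs.1]; ring_nf
      have e2 : ((t : ℝ) - s).toNNReal = ((t : ℝ) - y).toNNReal + (y - s).toNNReal := by
        rw [← Real.toNNReal_add (by linarith [hy.2]) hys]; ring_nf
      have e3 : slope v s y = T ((t : ℝ) - y).toNNReal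
          (((((y - s).toNNReal : ℝ)⁻¹ : ℝ) : 𝕜) • (S (y - s).toNNReal w - w)
            - ((((y - s).toNNReal : ℝ)⁻¹ : ℝ) : 𝕜) • (T (y - s).toNNReal w - w)) := by
        rw [slope_def_module, hv]
        simp only [e1, e2, hS.apply_add, hT.apply_add]
        rw [← smul_sub, map_smul, Real.coe_toNNReal _ hys, RCLike.real_smul_eq_coe_smul (K := 𝕜),
          sub_sub_sub_cancel_right, map_sub]
      rw [e3]
      exact hle _ _
    have := constant_of_has_deriv_right_zero hcont.continuousOn hder t ⟨t.2, le_rfl⟩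
    simpa [hv, hT.map_zero, hS.map_zero] using this
  funext t
  refine ContinuousLinearMap.ext fun u => ?_
  have := (S t).continuous.ext_on hA (T t).continuous fun u hu => by
    obtain ⟨f, hf⟩ := hu
    exact key u f hf t
  exact congrFun this u

end C0Semigroups

/-! ### Partial derivatives and integration by parts. -/

section CoordinateCalculus

variable {d : ℕ}

/-- The partial derivative with respect to the `i`-th coordinate. -/
noncomputable def partialDeriv (i : Fin d) (φ : EuclideanSpace ℝ (Fin d) → ℝ)
    (x : EuclideanSpace ℝ (Fin d)) : ℝ :=
  fderiv ℝ φ x (EuclideanSpace.single i 1)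

lemma ContDiff.partialDeriv {m n : WithTop ℕ∞} {φ : EuclideanSpace ℝ (Fin d) → ℝ}
    (hφ : ContDiff ℝ n φ) (hmn : m + 1 ≤ n) (i : Fin d) : ContDiff ℝ m (partialDeriv i φ) :=
  (hφ.fderiv_right hmn).clm_apply contDiff_const

lemma HasCompactSupport.partialDeriv {φ : EuclideanSpace ℝ (Fin d) → ℝ}
    (hφ : HasCompactSupport φ) (i : Fin d) : HasCompactSupport (partialDeriv i φ) :=
  hφ.fderiv_apply ℝ _

lemma HasFDerivAt.partialDeriv {φ : EuclideanSpace ℝ (Fin d) → ℝ}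
    {φ' : EuclideanSpace ℝ (Fin d) →L[ℝ] ℝ} {x : EuclideanSpace ℝ (Fin d)}
    (h : HasFDerivAt φ φ' x) (i : Fin d) :
    partialDeriv i φ x = φ' (EuclideanSpace.single i 1) := by
  rw [_root_.partialDeriv, h.fderiv]

lemma partialDeriv_mul {φ ψ : EuclideanSpace ℝ (Fin d) → ℝ} (hφ : Differentiable ℝ φ)
    (hψ : Differentiable ℝ ψ) (i : Fin d) :
    partialDeriv i (fun x => φ x * ψ x)
      = fun x => partialDeriv i φ x * ψ x + φ x * partialDeriv i ψ x := by
  funext x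
  refine (((hφ x).hasFDerivAt.mul (hψ x).hasFDerivAt).partialDeriv i).trans ?_
  simp [partialDeriv]
  ring

lemma partialDeriv_comp_smul {φ : EuclideanSpace ℝ (Fin d) → ℝ} (hφ : Differentiable ℝ φ)
    (r : ℝ) (i : Fin d) :
    partialDeriv i (fun x => φ (r • x)) = fun x => r * partialDeriv i φ (r • x) := by
  funext x
  have h := (hφ (r • x)).hasFDerivAt.comp x ((hasFDerivAt_id x).const_smul r)
  exact (h.partialDeriv i).trans (by simp [partialDeriv])

lemma partialDeriv_const_mul {φ : EuclideanSpace ℝ (Fin d) → ℝ} (hφ : Differentiable ℝ φ)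
    (c : ℝ) (i : Fin d) :
    partialDeriv i (fun x => c * φ x) = fun x => c * partialDeriv i φ x := by
  funext x
  rw [((hφ x).hasFDerivAt.const_mul c).partialDeriv i]
  simp [partialDeriv]

lemma ouExpr_eq_sum {φ : EuclideanSpace ℝ (Fin d) → ℝ} (hφ : ContDiff ℝ 2 φ)
    (x : EuclideanSpace ℝ (Fin d)) :
    ouExpr φ x
      = ∑ i, (1 / 2 * partialDeriv i (partialDeriv i φ) x - x i * partialDeriv i φ x) := by
  have h1 : Laplacian.laplacian φ x = ∑ i, partialDeriv i (partialDeriv i φ) x := by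
    rw [laplacian_eq_iteratedFDeriv_orthonormalBasis φ (EuclideanSpace.basisFun (Fin d) ℝ)]
    refine Finset.sum_congr rfl fun i _ => ?_
    rw [iteratedFDeriv_two_apply]
    have hd : DifferentiableAt ℝ (fderiv ℝ φ) x :=
      (hφ.fderiv_right (m := 1) (by norm_num)).differentiable (by norm_num) x
    have := hd.hasFDerivAt.clm_apply
      (hasFDerivAt_const (EuclideanSpace.single i (1 : ℝ)) x)
    rw [partialDeriv, show partialDeriv i φ = fun y => fderiv ℝ φ y (EuclideanSpace.single i 1)
      from rfl, this.fderiv]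
    simp
  have h2 : inner ℝ x (gradient φ x) = ∑ i, x i * partialDeriv i φ x := by
    rw [real_inner_comm, gradient, toDual_symm_apply]
    have hx := (EuclideanSpace.basisFun (Fin d) ℝ).sum_repr x
    have := congrArg (fderiv ℝ φ x) hx
    rw [map_sum] at this
    rw [← this]
    simp [partialDeriv]
  rw [ouExpr, h1, h2, Finset.mul_sum, ← Finset.sum_sub_distrib]

lemma ouExpr_mul {φ ψ : EuclideanSpace ℝ (Fin d) → ℝ} (hφ : ContDiff ℝ 2 φ)
    (hψ : ContDiff ℝ 2 ψ) (x : EuclideanSpace ℝ (Fin d)) :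
    ouExpr (fun x => φ x * ψ x) x = φ x * ouExpr ψ x + ψ x * ouExpr φ x
      + ∑ i, partialDeriv i φ x * partialDeriv i ψ x := by
  have dφ := hφ.differentiable (by norm_num)
  have dψ := hψ.differentiable (by norm_num)
  have d1φ := fun i => (hφ.partialDeriv (m := 1) (by norm_num) i).differentiable (by norm_num)
  have d1ψ := fun i => (hψ.partialDeriv (m := 1) (by norm_num) i).differentiable (by norm_num)
  rw [ouExpr_eq_sum hφ, ouExpr_eq_sum hψ, ouExpr_eq_sum (hφ.mul hψ), Finset.mul_sum,
    Finset.mul_sum, ← Finset.sum_add_distrib, ← Finset.sum_add_distrib]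
  refine Finset.sum_congr rfl fun i _ => ?_
  have e : partialDeriv i (fun x => partialDeriv i φ x * ψ x + φ x * partialDeriv i ψ x) x
      = partialDeriv i (fun x => partialDeriv i φ x * ψ x) x
        + partialDeriv i (fun x => φ x * partialDeriv i ψ x) x := by
    have h1 : DifferentiableAt ℝ (fun x => partialDeriv i φ x * ψ x) x :=
      ((d1φ i).mul dψ) x
    have h2 : DifferentiableAt ℝ (fun x => φ x * partialDeriv i ψ x) x :=
      (dφ.mul (d1ψ i)) x
    exact (h1.hasFDerivAt.add h2.hasFDerivAt).partialDeriv i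
  rw [partialDeriv_mul dφ dψ, e, partialDeriv_mul (d1φ i) dψ, partialDeriv_mul dφ (d1ψ i)]
  ring

lemma partialDeriv_gaussDensity (i : Fin d) :
    partialDeriv i (gaussDensity : EuclideanSpace ℝ (Fin d) → ℝ)
      = fun x => -(2 * x i * gaussDensity x) := by
  funext x
  have h := (((hasStrictFDerivAt_norm_sq x).hasFDerivAt.neg).exp).const_mul
    (Real.pi ^ (-(d : ℝ) / 2))
  refine (h.partialDeriv i).trans ?_
  simp [gaussDensity, EuclideanSpace.inner_single_right]
  ring

/-- Integration by parts in the `i`-th coordinate with respect to the Gaussian measure. -/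
lemma integral_ou_coord_mul {f g : EuclideanSpace ℝ (Fin d) → ℝ} (hf : ContDiff ℝ 2 f)
    (hg : ContDiff ℝ 2 g) (hc : HasCompactSupport f ∨ HasCompactSupport g) (i : Fin d) :
    ∫ x, gaussDensity x * ((1 / 2 * partialDeriv i (partialDeriv i f) x
        - x i * partialDeriv i f x) * g x)
      = -(1 / 2) * ∫ x, gaussDensity x * (partialDeriv i f x * partialDeriv i g x) := by
  have df1 := hf.partialDeriv (m := 1) (by norm_num) i
  have dg1 := hg.partialDeriv (m := 1) (by norm_num) i
  -- `∂ᵢG` is twice the density times the `i`-th summand of `Lf`, so the claim is one integration by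
  -- parts for Lebesgue measure.
  set G : EuclideanSpace ℝ (Fin d) → ℝ := fun x => gaussDensity x * partialDeriv i f x with hG
  have hGc : ContDiff ℝ 1 G := gaussDensity_contDiff.mul df1
  have hG' : partialDeriv i G = fun x => gaussDensity x *
      (partialDeriv i (partialDeriv i f) x - 2 * (x i * partialDeriv i f x)) := by
    rw [hG, partialDeriv_mul (gaussDensity_contDiff.differentiable (n := 1) (by norm_num))
      (df1.differentiable (by norm_num)), partialDeriv_gaussDensity]
    funext x; ring
  have hGs : HasCompactSupport f → HasCompactSupport G := fun h => (h.partialDeriv i).mul_left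
  have hsupp : ∀ {F1 F2 : EuclideanSpace ℝ (Fin d) → ℝ}, Continuous F1 → Continuous F2 →
      (HasCompactSupport f → HasCompactSupport F2) → (HasCompactSupport g → HasCompactSupport F1) →
      Integrable (fun x => F1 x * F2 x) := by
    intro F1 F2 c1 c2 h2 h1
    refine (c1.mul c2).integrable_of_hasCompactSupport ?_
    rcases hc with h | h
    · exact (h2 h).mul_left
    · exact (h1 h).mul_right
  have key := integral_mul_fderiv_eq_neg_fderiv_mul_of_integrable (μ := volume) (𝕜 := ℝ)
    (f := g) (g := G) (v := EuclideanSpace.single i (1 : ℝ))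
    (hsupp dg1.continuous hGc.continuous hGs fun h => h.partialDeriv i)
    (hsupp hg.continuous (hGc.partialDeriv (m := 0) (by norm_num) i).continuous
      (fun h => (hGs h).partialDeriv i) id)
    (hsupp hg.continuous hGc.continuous hGs id)
    (fun x _ => hg.differentiable (by norm_num) x)
    (fun x _ => hGc.differentiable (by norm_num) x)
  change ∫ x, g x * partialDeriv i G x = -∫ x, partialDeriv i g x * G x at key
  rw [hG', hG] at key
  calc _ = ∫ x, (1 / 2) * (g x * (gaussDensity x *
      (partialDeriv i (partialDeriv i f) x - 2 * (x i * partialDeriv i f x)))) := by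
        congr 1; funext x; ring
    _ = _ := by
      rw [integral_const_mul, key, mul_neg, neg_mul]
      congr 3; funext x; ring

/-- The right side is the Dirichlet form, which is symmetric in `f` and `g`. Compact support of
either function suffices, so the formula may be used with the roles exchanged. -/
lemma integral_ouExpr_mul {f g : EuclideanSpace ℝ (Fin d) → ℝ} (hf : ContDiff ℝ 2 f)
    (hg : ContDiff ℝ 2 g) (hc : HasCompactSupport f ∨ HasCompactSupport g) :
    ∫ x, ouExpr f x * g x ∂(gaussMeasure d)
      = ∑ i, -(1 / 2) * ∫ x, gaussDensity x * (partialDeriv i f x * partialDeriv i g x) := by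
  rw [integral_gaussMeasure]
  have e : ∀ x, gaussDensity x • (ouExpr f x * g x) = ∑ i, gaussDensity x *
      ((1 / 2 * partialDeriv i (partialDeriv i f) x - x i * partialDeriv i f x) * g x) := by
    intro x
    rw [ouExpr_eq_sum hf, smul_eq_mul, Finset.sum_mul, Finset.mul_sum]
  simp only [e]
  rw [integral_finsetSum]
  · exact Finset.sum_congr rfl fun i _ => integral_ou_coord_mul hf hg hc i
  · intro i _
    have df1 := hf.partialDeriv (m := 1) (by norm_num) i
    have df2 := df1.partialDeriv (m := 0) (by norm_num) i
    have c1 := df1.continuous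
    have c2 := df2.continuous
    have c3 := hg.continuous
    refine Continuous.integrable_of_hasCompactSupport ?_ ?_
    · exact gaussDensity_continuous.mul (by fun_prop)
    · refine HasCompactSupport.mul_left ?_
      rcases hc with h | h
      · exact (((h.partialDeriv i).partialDeriv i).mul_left.sub
          (h.partialDeriv i).mul_left).mul_right
      · exact h.mul_left

/-- The Ornstein-Uhlenbeck expression is formally symmetric with respect to the Gaussian
measure. -/
lemma integral_ouExpr_mul_comm {f g : EuclideanSpace ℝ (Fin d) → ℝ} (hf : ContDiff ℝ 2 f)
    (hg : ContDiff ℝ 2 g) (hc : HasCompactSupport f) :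
    ∫ x, ouExpr f x * g x ∂(gaussMeasure d) = ∫ x, f x * ouExpr g x ∂(gaussMeasure d) := by
  simp only [mul_comm (f _)]
  rw [integral_ouExpr_mul hf hg (Or.inl hc), integral_ouExpr_mul hg hf (Or.inr hc)]
  simp only [mul_comm (partialDeriv _ f _)]

end CoordinateCalculus

lemma MeasureTheory.MemLp.integrable_real_smul {α 𝕜 : Type*} [RCLike 𝕜] [MeasurableSpace α]
    {μ : Measure α} {φ : α → ℝ} {u : α → 𝕜} (hφ : MemLp φ 2 μ) (hu : MemLp u 2 μ) :
    Integrable (fun x => φ x • u x) μ := by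
  refine (hφ.ofReal (K := 𝕜).integrable_mul hu).congr (Eventually.of_forall fun x => ?_)
  simp [RCLike.real_smul_eq_coe_mul]

/-! ### Enlarging the class of test functions in the weak equation. -/

section WeakEquation

variable {d : ℕ} {𝕜 : Type*} [RCLike 𝕜]

/-- The weak equation may be tested with smooth functions that are bounded together with their
gradient and are mapped to `L²` by the Ornstein-Uhlenbeck expression. -/
lemma integral_ouExpr_smul_eq_of_mem_ouGraph {u f : GaussL2 𝕜 d} (h : (u, f) ∈ ouGraph 𝕜 d)
    {ψ : EuclideanSpace ℝ (Fin d) → ℝ} (hψ : ContDiff ℝ ∞ ψ) {C : ℝ} (hC : ∀ x, |ψ x| ≤ C)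
    (hC' : ∀ i x, |partialDeriv i ψ x| ≤ C) (hL : MemLp (ouExpr ψ) 2 (gaussMeasure d)) :
    ∫ x, ouExpr ψ x • u x ∂(gaussMeasure d) = ∫ x, ψ x • f x ∂(gaussMeasure d) := by
  have hC0 : 0 ≤ C := (abs_nonneg _).trans (hC 0)
  -- The test functions will be `χ (r x) ψ x` with `r ↓ 0`.
  let χ : ContDiffBump (0 : EuclideanSpace ℝ (Fin d)) := ⟨1, 2, one_pos, one_lt_two⟩
  have hχ : ContDiff ℝ ∞ (χ : EuclideanSpace ℝ (Fin d) → ℝ) := χ.contDiff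
  have hχc : HasCompactSupport (χ : EuclideanSpace ℝ (Fin d) → ℝ) := χ.hasCompactSupport
  have d1 : ∀ i, ContDiff ℝ ∞ (partialDeriv i χ) := fun i => hχ.partialDeriv (by simp) i
  have d2 : ∀ i, ContDiff ℝ ∞ (partialDeriv i (partialDeriv i χ)) := fun i =>
    (d1 i).partialDeriv (by simp) i
  have hbdd : ∀ g : EuclideanSpace ℝ (Fin d) → ℝ, Continuous g → HasCompactSupport g →
      ∃ B, 0 ≤ B ∧ ∀ x, |g x| ≤ B := by
    intro g hg hgc
    obtain ⟨B, hB⟩ := hgc.exists_bound_of_continuous hg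
    exact ⟨B, (norm_nonneg _).trans (hB 0), hB⟩
  have hg1 : ∀ i, ∃ B, 0 ≤ B ∧ ∀ x, |partialDeriv i χ x| ≤ B := fun i =>
    hbdd _ (d1 i).continuous (hχc.partialDeriv i)
  have hg2 : ∀ i, ∃ B, 0 ≤ B ∧ ∀ x, |partialDeriv i (partialDeriv i χ) x| ≤ B := fun i =>
    hbdd _ (d2 i).continuous ((hχc.partialDeriv i).partialDeriv i)
  -- The drift hits the cutoff in `xᵢ r ∂ᵢχ(r x)`, which is `yᵢ ∂ᵢχ(y)` at `y = r x`. It is thus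
  -- bounded uniformly in `r` despite the unbounded factor `xᵢ`.
  have hg3 : ∀ i, ∃ B, 0 ≤ B ∧ ∀ x : EuclideanSpace ℝ (Fin d), |x i * partialDeriv i χ x| ≤ B :=
    fun i => by
      have := (d1 i).continuous
      exact hbdd _ (by fun_prop) (hχc.partialDeriv i).mul_left
  choose B1 hB10 hB1 using hg1
  choose B2 hB20 hB2 using hg2
  choose B3 hB30 hB3 using hg3
  have hχr : ∀ r : ℝ, ContDiff ℝ ∞ fun x => χ (r • x) := fun r => hχ.comp (by fun_prop)
  have hψ2 : ContDiff ℝ 2 ψ := contDiff_infty.mp hψ 2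
  have hχ2 : ContDiff ℝ 2 (χ : EuclideanSpace ℝ (Fin d) → ℝ) :=
    contDiff_infty.mp hχ 2
  have dχ := hχ2.differentiable (by norm_num)
  -- `J r` is `L (χ(r·) ψ)` expanded by the product rule. It is continuous in `r` and equals `Lψ` at
  -- `r = 0`, so the limit needs only dominated convergence.
  set J : ℝ → EuclideanSpace ℝ (Fin d) → ℝ := fun r x => χ (r • x) * ouExpr ψ x
    + ψ x * (∑ i, (1 / 2 * (r * (r * partialDeriv i (partialDeriv i χ) (r • x)))
      - x i * (r * partialDeriv i χ (r • x))))
    + ∑ i, r * partialDeriv i χ (r • x) * partialDeriv i ψ x with hJ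
  have hJeq : ∀ r, ouExpr (fun x => χ (r • x) * ψ x) = J r := by
    intro r
    funext x
    rw [ouExpr_mul (contDiff_infty.mp (hχr r) 2) hψ2,
      ouExpr_eq_sum (contDiff_infty.mp (hχr r) 2), hJ]
    have e : ∀ i, partialDeriv i (fun x => r * partialDeriv i χ (r • x))
        = fun x => r * (r * partialDeriv i (partialDeriv i χ) (r • x)) := by
      intro i
      have hd := (d1 i).differentiable (by simp)
      rw [partialDeriv_const_mul (φ := fun x => partialDeriv i χ (r • x))
        (hd.comp (by fun_prop)), partialDeriv_comp_smul hd]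
    simp only [partialDeriv_comp_smul dχ, e]
  have hχ1 : ∀ x, |χ x| ≤ 1 := fun x => by
    rw [abs_of_nonneg χ.nonneg]; exact χ.le_one
  have hcontψL : Continuous (ouExpr ψ) := ouExpr_continuous hψ
  have hcψ := hψ.continuous
  have hcχ := hχ.continuous
  have hcdψ : ∀ i, Continuous (partialDeriv i ψ) := fun i =>
    (hψ.partialDeriv (m := ∞) (by simp) i).continuous
  have hcd1 := fun i => (d1 i).continuous
  have hcd2 := fun i => (d2 i).continuous
  have hJc : ∀ r, Continuous (J r) := by
    intro r
    rw [hJ]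
    fun_prop
  have hJbound : ∀ r ∈ Set.Ioc (0 : ℝ) 1, ∀ x, |J r x| ≤ |ouExpr ψ x|
      + (C * (∑ i, (B2 i + B3 i)) + ∑ i, B1 i * C) := by
    intro r hr x
    have hr0 : |r| ≤ 1 := abs_le.mpr ⟨by linarith [hr.1], hr.2⟩
    rw [hJ, ← add_assoc]
    refine (abs_add_le _ _).trans (add_le_add ((abs_add_le _ _).trans (add_le_add ?_ ?_)) ?_)
    · rw [abs_mul]
      exact mul_le_of_le_one_left (abs_nonneg _) (hχ1 _)
    · rw [abs_mul]
      refine mul_le_mul (hC x) ?_ (abs_nonneg _) hC0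
      refine (Finset.abs_sum_le_sum_abs _ _).trans (Finset.sum_le_sum fun i _ => ?_)
      refine (abs_sub _ _).trans (add_le_add ?_ ?_)
      · rw [abs_mul, abs_mul, abs_mul]
        have h1 : |r| * |partialDeriv i (partialDeriv i χ) (r • x)| ≤ B2 i :=
          (mul_le_of_le_one_left (abs_nonneg _) hr0).trans (hB2 i _)
        have h2 := (mul_le_of_le_one_left (by positivity) hr0).trans h1
        calc |(1 : ℝ) / 2| * (|r| * (|r| * |partialDeriv i (partialDeriv i χ) (r • x)|))
            ≤ 1 * B2 i := mul_le_mul (by norm_num [abs_of_pos]) h2 (by positivity) zero_le_one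
          _ = B2 i := one_mul _
      · have := hB3 i (r • x)
        rw [PiLp.smul_apply, smul_eq_mul] at this
        rw [← mul_assoc, mul_comm (x i) r]
        exact this
    · refine (Finset.abs_sum_le_sum_abs _ _).trans (Finset.sum_le_sum fun i _ => ?_)
      rw [abs_mul, abs_mul]
      exact mul_le_mul ((mul_le_of_le_one_left (abs_nonneg _) hr0).trans (hB1 i _)) (hC' i x)
        (abs_nonneg _) (hB10 i)
  have hu := Lp.memLp u
  have hf := Lp.memLp f
  have hmem : Set.Ioc (0 : ℝ) 1 ∈ 𝓝[>] (0 : ℝ) := Ioc_mem_nhdsGT one_pos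
  have lim1 : Tendsto (fun r => ∫ x, J r x • u x ∂(gaussMeasure d)) (𝓝[>] 0)
      (𝓝 (∫ x, ouExpr ψ x • u x ∂(gaussMeasure d))) := by
    refine tendsto_integral_filter_of_dominated_convergence
      (fun x => ‖(|ouExpr ψ x| + (C * (∑ i, (B2 i + B3 i)) + ∑ i, B1 i * C)) • u x‖)
      (Eventually.of_forall fun r => (hJc r).aestronglyMeasurable.smul hu.1) ?_
      ((hL.norm.add (memLp_const _)).integrable_real_smul hu).norm
      (Eventually.of_forall fun x => ?_)
    · filter_upwards [hmem] with r hr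
      refine Eventually.of_forall fun x => ?_
      rw [norm_smul, norm_smul]
      gcongr
      exact (hJbound r hr x).trans (le_abs_self _)
    · have hcont : Continuous fun r => J r x := by
        rw [hJ]; fun_prop
      have := (hcont.tendsto 0).mono_left (nhdsWithin_le_nhds (s := Set.Ioi (0 : ℝ)))
      have h0 : J 0 x = ouExpr ψ x := by
        simp [hJ, χ.eventuallyEq_one.eq_of_nhds]
      rw [h0] at this
      exact this.smul_const _
  have lim2 : Tendsto (fun r : ℝ => ∫ x, (χ (r • x) * ψ x) • f x ∂(gaussMeasure d)) (𝓝[>] 0)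
      (𝓝 (∫ x, ψ x • f x ∂(gaussMeasure d))) := by
    refine tendsto_integral_filter_of_dominated_convergence (fun x => ‖C • f x‖)
      (Eventually.of_forall fun r => Continuous.aestronglyMeasurable (by fun_prop) |>.smul hf.1)
      (Eventually.of_forall fun r => Eventually.of_forall fun x => ?_)
      ((hf.integrable (by norm_num)).smul C).norm
      (Eventually.of_forall fun x => ?_)
    · rw [norm_smul, norm_smul, Real.norm_eq_abs, Real.norm_eq_abs, abs_mul, abs_of_nonneg hC0]
      gcongr
      exact (mul_le_of_le_one_left (abs_nonneg _) (hχ1 _)).trans (hC x)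
    · have hcont : Continuous fun r : ℝ => χ (r • x) * ψ x := by fun_prop
      have := (hcont.tendsto 0).mono_left (nhdsWithin_le_nhds (s := Set.Ioi (0 : ℝ)))
      have h0 : χ ((0 : ℝ) • x) * ψ x = ψ x := by
        simp [χ.eventuallyEq_one.eq_of_nhds]
      rw [h0] at this
      exact this.smul_const _
  refine tendsto_nhds_unique lim1 (lim2.congr' ?_)
  filter_upwards [hmem] with r hr
  have hsupp : HasCompactSupport fun x => χ (r • x) * ψ x :=
    HasCompactSupport.mul_right (hχc.comp_homeomorph (Homeomorph.smulOfNeZero r hr.1.ne'))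
  have := h (fun x => χ (r • x) * ψ x) ((hχr r).mul hψ) hsupp
  rw [hJeq] at this
  exact this.symm

lemma trigFun_contDiff (ξ : EuclideanSpace ℝ (Fin d)) (a : ℝ) {n : WithTop ℕ∞} :
    ContDiff ℝ n (trigFun ξ a) := by
  unfold trigFun
  exact Real.contDiff_cos.comp ((contDiff_const.inner ℝ contDiff_id).add contDiff_const)

/-- Writing `-sin θ` as `cos (θ + π/2)` keeps the derivatives inside the family; this is the purpose
of the phase. -/
lemma partialDeriv_trigFun (ξ : EuclideanSpace ℝ (Fin d)) (a : ℝ) (i : Fin d) :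
    partialDeriv i (trigFun ξ a) = fun x => ξ i * trigFun ξ (a + Real.pi / 2) x := by
  funext x
  have h := ((innerSL ℝ ξ).hasFDerivAt (x := x)).add_const a |>.cos
  refine (h.partialDeriv i).trans ?_
  simp [trigFun, ← add_assoc, Real.cos_add_pi_div_two, EuclideanSpace.inner_single_right]
  ring

lemma ouExpr_trigFun (ξ : EuclideanSpace ℝ (Fin d)) (a : ℝ) (x : EuclideanSpace ℝ (Fin d)) :
    ouExpr (trigFun ξ a) x
      = -(1 / 2) * ‖ξ‖ ^ 2 * trigFun ξ a x - inner ℝ ξ x * trigFun ξ (a + Real.pi / 2) x := by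
  rw [ouExpr_eq_sum (trigFun_contDiff ξ a)]
  have e : ∀ i, partialDeriv i (partialDeriv i (trigFun ξ a)) x = -(ξ i ^ 2 * trigFun ξ a x) := by
    intro i
    rw [partialDeriv_trigFun, partialDeriv_const_mul
      ((trigFun_contDiff ξ _ (n := 1)).differentiable (by norm_num)), partialDeriv_trigFun]
    have : trigFun ξ (a + Real.pi / 2 + Real.pi / 2) x = -trigFun ξ a x := by
      rw [trigFun, add_assoc a, add_halves, ← add_assoc, Real.cos_add_pi]; rfl
    simp only [this]
    ring
  simp only [e]
  simp only [partialDeriv_trigFun]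
  rw [EuclideanSpace.norm_sq_eq, PiLp.inner_apply, Finset.mul_sum, Finset.sum_mul, Finset.sum_mul,
    ← Finset.sum_sub_distrib]
  refine Finset.sum_congr rfl fun i _ => ?_
  simp
  ring

lemma memLp_ouExpr_trigFun (ξ : EuclideanSpace ℝ (Fin d)) (a : ℝ) :
    MemLp (ouExpr (trigFun ξ a)) 2 (gaussMeasure d) := by
  have hb1 : MemLp (fun _ : EuclideanSpace ℝ (Fin d) => 1 / 2 * ‖ξ‖ ^ 2) 2 (gaussMeasure d) :=
    memLp_const _
  have hb2 : MemLp (fun x : EuclideanSpace ℝ (Fin d) => ‖ξ‖ * ‖x‖) 2 (gaussMeasure d) :=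
    memLp_norm_gaussMeasure.const_mul _
  refine (hb1.add hb2).mono (ouExpr_continuous (trigFun_contDiff ξ a)).aestronglyMeasurable
    (Eventually.of_forall fun x => ?_)
  rw [ouExpr_trigFun]
  refine ((norm_sub_le _ _).trans (add_le_add ?_ ?_)).trans (le_abs_self _)
  · rw [neg_mul, neg_mul, norm_neg, norm_mul, Real.norm_of_nonneg (by positivity)]
    exact mul_le_of_le_one_right (by positivity) (abs_trigFun_le _ _ _)
  · rw [norm_mul]
    exact (mul_le_of_le_one_right (norm_nonneg _) (abs_trigFun_le _ _ _)).trans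
      (norm_inner_le_norm _ _)

lemma integral_ouExpr_trigFun_smul_eq_of_mem_ouGraph {u f : GaussL2 𝕜 d}
    (h : (u, f) ∈ ouGraph 𝕜 d) (ξ : EuclideanSpace ℝ (Fin d)) (a : ℝ) :
    ∫ x, ouExpr (trigFun ξ a) x • u x ∂(gaussMeasure d)
      = ∫ x, trigFun ξ a x • f x ∂(gaussMeasure d) := by
  refine integral_ouExpr_smul_eq_of_mem_ouGraph h (trigFun_contDiff ξ a) (C := max 1 ‖ξ‖)
    (fun x => (abs_trigFun_le _ _ _).trans (le_max_left _ _)) (fun i x => ?_)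
    (memLp_ouExpr_trigFun ξ a)
  rw [partialDeriv_trigFun, abs_mul]
  exact (mul_le_of_le_one_right (abs_nonneg _) (abs_trigFun_le _ _ _)).trans
    ((PiLp.norm_apply_le ξ i).trans (le_max_right _ _))

end WeakEquation

/-! ### Operators with square integrable kernels. -/

section SquareIntegrableKernels

variable {α : Type*} [MeasurableSpace α] {μ : Measure α} {𝕜 : Type*} [RCLike 𝕜]

lemma norm_integral_smul_sq_le {φ : α → ℝ} {u : α → 𝕜} (hφ : MemLp φ 2 μ) (hu : MemLp u 2 μ) :
    ‖∫ y, φ y • u y ∂μ‖ ^ 2 ≤ (∫ y, φ y ^ 2 ∂μ) * ∫ y, ‖u y‖ ^ 2 ∂μ := by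
  have h1 : ‖∫ y, φ y • u y ∂μ‖ ≤ ∫ y, ‖φ y‖ * ‖u y‖ ∂μ := by
    refine (norm_integral_le_integral_norm _).trans_eq ?_
    simp only [norm_smul]
  have h2 := integral_mul_le_Lp_mul_Lq_of_nonneg (μ := μ) Real.HolderConjugate.two_two
    (Eventually.of_forall fun y => norm_nonneg (φ y))
    (Eventually.of_forall fun y => norm_nonneg (u y))
    (by simpa using hφ.norm) (by simpa using hu.norm)
  simp only [Real.rpow_two, ← Real.sqrt_eq_rpow] at h2
  have h3 : ∫ y, ‖φ y‖ ^ 2 ∂μ = ∫ y, φ y ^ 2 ∂μ := by simp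
  rw [h3] at h2
  calc ‖∫ y, φ y • u y ∂μ‖ ^ 2
      ≤ (Real.sqrt (∫ y, φ y ^ 2 ∂μ) * Real.sqrt (∫ y, ‖u y‖ ^ 2 ∂μ)) ^ 2 := by
        gcongr; exact h1.trans h2
    _ = _ := by
      rw [mul_pow, Real.sq_sqrt (integral_nonneg fun _ => by positivity),
        Real.sq_sqrt (integral_nonneg fun _ => by positivity)]

/-- Cauchy–Schwarz for the splitting `f g = f^{1/2} (f g²)^{1/2}`, where `f` plays the role of a
weight. -/
lemma lintegral_mul_sq_le {f g : α → ENNReal} (hf : AEMeasurable f μ) (hg : AEMeasurable g μ) :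
    (∫⁻ y, f y * g y ∂μ) ^ 2 ≤ (∫⁻ y, f y ∂μ) * ∫⁻ y, f y * g y ^ 2 ∂μ := by
  have h := ENNReal.lintegral_mul_norm_pow_le (μ := μ) hf (hf.mul (hg.pow_const 2))
    (p := 1 / 2) (q := 1 / 2) (by norm_num) (by norm_num) (by norm_num)
  have e : ∀ z w : ENNReal, z ^ (1 / 2 : ℝ) * (z * w ^ 2) ^ (1 / 2 : ℝ) = z * w := by
    intro z w
    rw [ENNReal.mul_rpow_of_nonneg _ _ (by norm_num), ← mul_assoc,
      ← ENNReal.rpow_add_of_nonneg _ _ (by norm_num) (by norm_num), ← ENNReal.rpow_natCast,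
      ← ENNReal.rpow_mul]
    norm_num
  simp only [Pi.mul_apply, e] at h
  calc (∫⁻ y, f y * g y ∂μ) ^ 2
      ≤ ((∫⁻ y, f y ∂μ) ^ (1 / 2 : ℝ) * (∫⁻ y, f y * g y ^ 2 ∂μ) ^ (1 / 2 : ℝ)) ^ 2 := by
        gcongr
    _ = _ := by
      rw [mul_pow, ← ENNReal.rpow_natCast, ← ENNReal.rpow_natCast, ← ENNReal.rpow_mul,
        ← ENNReal.rpow_mul]
      norm_num

variable [SFinite μ] {k : α → α → ℝ}

lemma MeasureTheory.MemLp.kernel_ae_memLp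
    (hk : MemLp (Function.uncurry k) 2 (μ.prod μ)) : ∀ᵐ x ∂μ, MemLp (k x) 2 μ := by
  filter_upwards [hk.1.prodMk_left, hk.integrable_sq.prod_right_ae] with x h1 h2
  exact (memLp_two_iff_integrable_sq h1).mpr h2

lemma MeasureTheory.MemLp.kernel_ae_integrable (hk : MemLp (Function.uncurry k) 2 (μ.prod μ))
    {u : α → 𝕜} (hu : MemLp u 2 μ) : ∀ᵐ x ∂μ, Integrable (fun y => k x y • u y) μ := by
  filter_upwards [hk.kernel_ae_memLp] with x hx
  exact hx.integrable_real_smul hu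

/-- The Hilbert–Schmidt bound: Cauchy–Schwarz in `y` for almost every `x`, then integration in `x`.
-/
lemma MeasureTheory.MemLp.kernel_memLp (hk : MemLp (Function.uncurry k) 2 (μ.prod μ))
    {u : α → 𝕜} (hu : MemLp u 2 μ) : MemLp (fun x => ∫ y, k x y • u y ∂μ) 2 μ := by
  have hm : AEStronglyMeasurable (fun x => ∫ y, k x y • u y ∂μ) μ :=
    (hk.1.smul (hu.1.comp_snd (μ := μ))).integral_prod_right'
  rw [← memLp_norm_iff hm, memLp_two_iff_integrable_sq hm.norm]
  refine (hk.integrable_sq.integral_prod_left.mul_const (∫ y, ‖u y‖ ^ 2 ∂μ)).mono'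
    (hm.norm.pow 2) ?_
  filter_upwards [hk.kernel_ae_memLp] with x hx
  rw [norm_pow, norm_norm]
  exact norm_integral_smul_sq_le hx hu

/-- The operator on `L²` with a real square integrable kernel. -/
noncomputable def kernelOperator (𝕜 : Type*) [RCLike 𝕜]
    (hk : MemLp (Function.uncurry k) 2 (μ.prod μ)) : Lp 𝕜 2 μ →ₗ[𝕜] Lp 𝕜 2 μ where
  toFun u := (hk.kernel_memLp (Lp.memLp u)).toLp
  map_add' u v := by
    rw [← MemLp.toLp_add]
    refine MemLp.toLp_congr _ _ ?_
    filter_upwards [hk.kernel_ae_integrable (Lp.memLp u), hk.kernel_ae_integrable (Lp.memLp v)]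
      with x h1 h2
    rw [Pi.add_apply, ← integral_add h1 h2]
    refine integral_congr_ae ?_
    filter_upwards [Lp.coeFn_add u v] with y hy
    rw [hy, Pi.add_apply, smul_add]
  map_smul' c u := by
    rw [RingHom.id_apply, ← MemLp.toLp_const_smul]
    refine MemLp.toLp_congr _ _ (Eventually.of_forall fun x => ?_)
    simp only [Pi.smul_apply]
    rw [← integral_smul]
    refine integral_congr_ae ?_
    filter_upwards [Lp.coeFn_smul c u] with y hy
    rw [hy, Pi.smul_apply, smul_comm]

lemma kernelOperator_coeFn (hk : MemLp (Function.uncurry k) 2 (μ.prod μ)) (u : Lp 𝕜 2 μ) :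
    kernelOperator 𝕜 hk u =ᵐ[μ] fun x => ∫ y, k x y • u y ∂μ :=
  MemLp.coeFn_toLp (hk.kernel_memLp (Lp.memLp u))

/-- Fubini's theorem for square integrable kernels. -/
lemma integral_mul_kernel (hk : MemLp (Function.uncurry k) 2 (μ.prod μ)) {u v : α → 𝕜}
    (hu : MemLp u 2 μ) (hv : MemLp v 2 μ) :
    ∫ x, v x * ∫ y, k x y • u y ∂μ ∂μ = ∫ y, (∫ x, k x y • v x ∂μ) * u y ∂μ := by
  have hvu : MemLp (fun p : α × α => v p.1 * u p.2) 2 (μ.prod μ) := by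
    have hm : AEStronglyMeasurable (fun p : α × α => v p.1 * u p.2) (μ.prod μ) :=
      hv.1.comp_fst.mul hu.1.comp_snd
    rw [← memLp_norm_iff hm, memLp_two_iff_integrable_sq hm.norm]
    refine (hv.norm.integrable_sq.mul_prod hu.norm.integrable_sq).congr
      (Eventually.of_forall fun p => ?_)
    simp [mul_pow]
  have hint := hk.integrable_real_smul hvu
  have := integral_integral_swap (f := fun x y => k x y • (v x * u y)) hint
  calc _ = ∫ x, ∫ y, k x y • (v x * u y) ∂μ ∂μ := by
        refine integral_congr_ae (Eventually.of_forall fun x => ?_)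
        simp only
        rw [← integral_const_mul]
        simp only [mul_smul_comm]
    _ = _ := this
    _ = _ := by
        refine integral_congr_ae (Eventually.of_forall fun y => ?_)
        simp only
        rw [← integral_mul_const]
        simp only [smul_mul_assoc]

/-- This transfers a weak identity for the operator to an identity for its kernel at each fixed `y`.
-/
lemma integral_real_smul_kernelOperator (hk : MemLp (Function.uncurry k) 2 (μ.prod μ))
    {φ : α → ℝ} (hφ : MemLp φ 2 μ) (u : Lp 𝕜 2 μ) :
    ∫ x, φ x • kernelOperator 𝕜 hk u x ∂μ = ∫ y, (∫ x, k x y * φ x ∂μ) • u y ∂μ := by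
  calc _ = _ := ?_
    _ = _ := integral_mul_kernel hk (Lp.memLp u) (hφ.ofReal (K := 𝕜))
    _ = _ := ?_
  · refine integral_congr_ae ?_
    filter_upwards [kernelOperator_coeFn hk u] with x hx
    rw [hx, RCLike.real_smul_eq_coe_mul]
  · refine integral_congr_ae (Eventually.of_forall fun y => ?_)
    simp only [RCLike.real_smul_eq_coe_mul, ← integral_ofReal, RCLike.ofReal_mul]

/-- The Schur test for sub-Markovian kernels. -/
lemma norm_kernelOperator_le (hk : MemLp (Function.uncurry k) 2 (μ.prod μ))
    (hm : Measurable (Function.uncurry k)) (h0 : ∀ x y, 0 ≤ k x y)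
    (h1 : ∀ x, ∫⁻ y, ENNReal.ofReal (k x y) ∂μ ≤ 1)
    (h2 : ∀ y, ∫⁻ x, ENNReal.ofReal (k x y) ∂μ ≤ 1) (u : Lp 𝕜 2 μ) :
    ‖kernelOperator 𝕜 hk u‖ ≤ ‖u‖ := by
  rw [Lp.norm_def, Lp.norm_def]
  refine ENNReal.toReal_mono (Lp.eLpNorm_ne_top u) ?_
  rw [eLpNorm_congr_ae (kernelOperator_coeFn hk u),
    eLpNorm_eq_lintegral_rpow_enorm_toReal two_ne_zero ENNReal.ofNat_ne_top,
    eLpNorm_eq_lintegral_rpow_enorm_toReal two_ne_zero ENNReal.ofNat_ne_top]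
  simp only [ENNReal.toReal_ofNat, ENNReal.rpow_two]
  refine ENNReal.rpow_le_rpow ?_ (by norm_num)
  have hu : AEMeasurable (fun y => ‖u y‖ₑ) μ := (Lp.aestronglyMeasurable u).enorm
  have hkm : Measurable fun p : α × α => ENNReal.ofReal (k p.1 p.2) := hm.ennreal_ofReal
  -- Weighted Cauchy–Schwarz in `y` uses the row bound `h1`; after exchanging the integrals, the
  -- column bound `h2` removes the kernel.
  calc ∫⁻ x, ‖∫ y, k x y • u y ∂μ‖ₑ ^ 2 ∂μ
      ≤ ∫⁻ x, ∫⁻ y, ENNReal.ofReal (k x y) * ‖u y‖ₑ ^ 2 ∂μ ∂μ := by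
        refine lintegral_mono fun x => ?_
        calc ‖∫ y, k x y • u y ∂μ‖ₑ ^ 2
            ≤ (∫⁻ y, ENNReal.ofReal (k x y) * ‖u y‖ₑ ∂μ) ^ 2 := by
              gcongr
              refine (enorm_integral_le_lintegral_enorm _).trans_eq ?_
              refine lintegral_congr fun y => ?_
              rw [enorm_smul, Real.enorm_of_nonneg (h0 x y)]
          _ ≤ (∫⁻ y, ENNReal.ofReal (k x y) ∂μ) * ∫⁻ y, ENNReal.ofReal (k x y) * ‖u y‖ₑ ^ 2 ∂μ :=
              lintegral_mul_sq_le (hkm.comp measurable_prodMk_left).aemeasurable hu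
          _ ≤ _ := mul_le_of_le_one_left zero_le (h1 x)
    _ = ∫⁻ y, ∫⁻ x, ENNReal.ofReal (k x y) * ‖u y‖ₑ ^ 2 ∂μ ∂μ :=
        lintegral_lintegral_swap (f := fun x y => ENNReal.ofReal (k x y) * ‖u y‖ₑ ^ 2)
          ((hkm.aemeasurable.mul ((hu.pow_const 2).comp_snd (μ := μ))).congr
            (Eventually.of_forall fun _ => rfl))
    _ ≤ ∫⁻ y, ‖u y‖ₑ ^ 2 ∂μ := by
        refine lintegral_mono fun y => ?_
        rw [lintegral_mul_const' _ _ (by finiteness)]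
        exact mul_le_of_le_one_left zero_le (h2 y)

end SquareIntegrableKernels

/-! ### The Mehler kernel: symmetry, growth and Gaussian integrals. -/

section MehlerKernel

variable {d : ℕ} {𝕜 : Type*} [RCLike 𝕜]

/-- Continuous kernels of moderate Gaussian growth are square integrable with respect to the
Gaussian measure. -/
lemma memLp_two_prod_gaussMeasure {k : EuclideanSpace ℝ (Fin d) → EuclideanSpace ℝ (Fin d) → ℝ}
    (hk : Continuous (Function.uncurry k)) {C c : ℝ} (hc : c < 1 / 2)
    (h : ∀ x y, |k x y| ≤ C * Real.exp (c * (‖x‖ ^ 2 + ‖y‖ ^ 2))) :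
    MemLp (Function.uncurry k) 2 ((gaussMeasure d).prod (gaussMeasure d)) := by
  rw [memLp_two_iff_integrable_sq hk.aestronglyMeasurable]
  -- Squaring the kernel doubles `c`, and `γ` absorbs exponents below 1; hence the threshold 1/2.
  have hi := integrable_exp_mul_norm_sq_gaussMeasure (d := d) (c := 2 * c) (by linarith)
  refine ((hi.mul_prod hi).const_mul (C ^ 2)).mono' (hk.pow 2).aestronglyMeasurable
    (Eventually.of_forall fun p => ?_)
  rw [norm_pow]
  calc ‖Function.uncurry k p‖ ^ 2
      ≤ (C * Real.exp (c * (‖p.1‖ ^ 2 + ‖p.2‖ ^ 2))) ^ 2 := by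
        gcongr
        exact h p.1 p.2
    _ = _ := by
        rw [mul_pow, ← Real.exp_nat_mul, ← Real.exp_add]
        push_cast
        ring_nf

lemma one_sub_exp_neg_two_mul_pos {t : ℝ} (ht : 0 < t) : 0 < 1 - Real.exp (-2 * t) := by
  have : Real.exp (-2 * t) < 1 := Real.exp_lt_one_iff.mpr (by linarith)
  linarith

lemma exp_neg_two_mul (t : ℝ) : Real.exp (-2 * t) = Real.exp (-t) ^ 2 := by
  rw [← Real.exp_nat_mul]; push_cast; ring_nf

lemma mehlerKernel_nonneg (t : ℝ) (ht : 0 < t) (x y : EuclideanSpace ℝ (Fin d)) :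
    0 ≤ mehlerKernel t x y := by
  have := one_sub_exp_neg_two_mul_pos ht
  unfold mehlerKernel; positivity

/-- Absorbing `exp ‖y‖²` into the quotient, with `1 - e^{-2t}` as common denominator, makes the
exponent symmetric in `x` and `y`. -/
lemma mehlerKernel_eq {t : ℝ} (ht : 0 < t) (x y : EuclideanSpace ℝ (Fin d)) :
    mehlerKernel t x y = ((1 - Real.exp (-2 * t)) ^ ((d : ℝ) / 2))⁻¹ *
      Real.exp (-((Real.exp (-t) ^ 2 * ‖x‖ ^ 2 - 2 * Real.exp (-t) * inner ℝ x y
        + Real.exp (-t) ^ 2 * ‖y‖ ^ 2) / (1 - Real.exp (-2 * t)))) := by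
  have hs := one_sub_exp_neg_two_mul_pos ht
  rw [mehlerKernel, div_mul_eq_mul_div, ← Real.exp_add, div_eq_inv_mul]
  congr 2
  rw [@norm_sub_sq_real, norm_smul, Real.norm_of_nonneg (Real.exp_pos _).le, real_inner_smul_left]
  rw [exp_neg_two_mul] at hs ⊢
  field_simp
  ring

lemma mehlerKernel_comm {t : ℝ} (ht : 0 < t) (x y : EuclideanSpace ℝ (Fin d)) :
    mehlerKernel t x y = mehlerKernel t y x := by
  rw [mehlerKernel_eq ht, mehlerKernel_eq ht, real_inner_comm]
  ring_nf

lemma continuous_mehlerKernel (t : ℝ) :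
    Continuous (Function.uncurry (mehlerKernel t) :
      EuclideanSpace ℝ (Fin d) × EuclideanSpace ℝ (Fin d) → ℝ) := by
  unfold mehlerKernel Function.uncurry
  fun_prop

/-- With `q = e^{-t}` and `2⟨x, y⟩ ≤ ‖x‖² + ‖y‖²`, the coefficient in the exponent becomes `(q -
q²)/(1 - q²) = q/(1 + q)`, which is below 1/2. -/
lemma mehlerKernel_le {t : ℝ} (ht : 0 < t) (x y : EuclideanSpace ℝ (Fin d)) :
    |mehlerKernel t x y| ≤ ((1 - Real.exp (-2 * t)) ^ ((d : ℝ) / 2))⁻¹ *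
      Real.exp (Real.exp (-t) / (1 + Real.exp (-t)) * (‖x‖ ^ 2 + ‖y‖ ^ 2)) := by
  have hs := one_sub_exp_neg_two_mul_pos ht
  rw [abs_of_nonneg (mehlerKernel_nonneg t ht x y), mehlerKernel_eq ht]
  gcongr
  set q := Real.exp (-t)
  have hq0 : 0 < q := Real.exp_pos _
  have hq1 : q < 1 := Real.exp_lt_one_iff.mpr (by linarith)
  have hsq : 1 - Real.exp (-2 * t) = (1 - q) * (1 + q) := by
    rw [exp_neg_two_mul]; ring
  have h1 : inner ℝ x y ≤ (‖x‖ ^ 2 + ‖y‖ ^ 2) / 2 := by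
    have := real_inner_le_norm x y
    nlinarith [sq_nonneg (‖x‖ - ‖y‖)]
  rw [hsq, ← neg_div, div_le_iff₀ (by nlinarith)]
  have e : q / (1 + q) * (‖x‖ ^ 2 + ‖y‖ ^ 2) * ((1 - q) * (1 + q))
      = q * (1 - q) * (‖x‖ ^ 2 + ‖y‖ ^ 2) := by
    field_simp
  rw [e]
  nlinarith

lemma exp_neg_div_one_add_lt {t : ℝ} (ht : 0 < t) :
    Real.exp (-t) / (1 + Real.exp (-t)) < 1 / 2 := by
  have hq0 : 0 < Real.exp (-t) := Real.exp_pos _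
  have hq1 : Real.exp (-t) < 1 := Real.exp_lt_one_iff.mpr (by linarith)
  rw [div_lt_div_iff₀ (by positivity) (by norm_num)]
  linarith

lemma memLp_mehlerKernel {t : ℝ} (ht : 0 < t) :
    MemLp (Function.uncurry (mehlerKernel t)) 2 ((gaussMeasure d).prod (gaussMeasure d)) :=
  memLp_two_prod_gaussMeasure (continuous_mehlerKernel t) (exp_neg_div_one_add_lt ht)
    (mehlerKernel_le ht)

/-- As a density in `x` with respect to Lebesgue measure, the kernel is a normalized Gaussian
centred at `e^{-t} y`. Its integrals in `x` reduce to a translation and a Gaussian Fourier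
transform. -/
lemma gaussDensity_mul_mehlerKernel {t : ℝ} (ht : 0 < t) (x y : EuclideanSpace ℝ (Fin d)) :
    gaussDensity x * mehlerKernel t x y =
      (Real.pi * (1 - Real.exp (-2 * t))) ^ (-(d : ℝ) / 2) *
        Real.exp (-(1 - Real.exp (-2 * t))⁻¹ * ‖x - Real.exp (-t) • y‖ ^ 2) := by
  have hs := one_sub_exp_neg_two_mul_pos ht
  rw [gaussDensity, mehlerKernel_eq ht, Real.mul_rpow Real.pi_pos.le hs.le, neg_div,
    Real.rpow_neg hs.le, mul_mul_mul_comm, ← Real.exp_add]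
  congr 2
  rw [@norm_sub_sq_real, norm_smul, Real.norm_of_nonneg (Real.exp_pos _).le, real_inner_smul_right]
  rw [exp_neg_two_mul] at hs ⊢
  field_simp
  ring

/-- Real part of `e^{ia}` times the Fourier transform of the Gaussian. -/
lemma integral_exp_neg_mul_norm_sq_mul_cos {b : ℝ} (hb : 0 < b) (ξ : EuclideanSpace ℝ (Fin d))
    (a : ℝ) : ∫ x : EuclideanSpace ℝ (Fin d), Real.exp (-b * ‖x‖ ^ 2) * trigFun ξ a x
      = (Real.pi / b) ^ ((d : ℝ) / 2) * Real.exp (-‖ξ‖ ^ 2 / (4 * b)) * Real.cos a := by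
  have hb' : 0 < (b : ℂ).re := by simpa using hb
  have h := GaussianFourier.integral_cexp_neg_mul_sq_norm_add (V := EuclideanSpace ℝ (Fin d))
    hb' Complex.I ξ
  have hi := GaussianFourier.integrable_cexp_neg_mul_sq_norm_add
    (V := EuclideanSpace ℝ (Fin d)) hb' Complex.I ξ
  have h2 := congrArg (fun z => Complex.re (Complex.exp (a * Complex.I) * z)) h
  rw [← integral_const_mul] at h2
  have h3 := integral_re (𝕜 := ℂ) (hi.const_mul (Complex.exp (a * Complex.I)))
  simp only [RCLike.re_to_complex] at h3
  rw [← h3] at h2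
  have e1 : ∀ x : EuclideanSpace ℝ (Fin d), (Complex.exp (a * Complex.I) *
      Complex.exp (-(b : ℂ) * ‖x‖ ^ 2 + Complex.I * (inner ℝ ξ x : ℝ))).re
      = Real.exp (-b * ‖x‖ ^ 2) * trigFun ξ a x := by
    intro x
    rw [← Complex.exp_add]
    rw [show (a : ℂ) * Complex.I + (-(b : ℂ) * ‖x‖ ^ 2 + Complex.I * (inner ℝ ξ x : ℝ))
      = ((-b * ‖x‖ ^ 2 : ℝ) : ℂ) + ((inner ℝ ξ x + a : ℝ) : ℂ) * Complex.I by push_cast; ring]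
    rw [Complex.exp_add, ← Complex.ofReal_exp, Complex.re_ofReal_mul,
      Complex.exp_ofReal_mul_I_re]
    rfl
  simp only [e1] at h2
  rw [h2]
  have e2 : ((Real.pi : ℂ) / b) ^ ((Module.finrank ℝ (EuclideanSpace ℝ (Fin d)) : ℂ) / 2)
      = (((Real.pi / b) ^ ((d : ℝ) / 2) : ℝ) : ℂ) := by
    rw [Complex.ofReal_cpow (by positivity)]
    simp
  have e3 : Complex.exp (Complex.I ^ 2 * ‖ξ‖ ^ 2 / (4 * b))
      = ((Real.exp (-‖ξ‖ ^ 2 / (4 * b)) : ℝ) : ℂ) := by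
    rw [Complex.I_sq]; push_cast; ring_nf
  rw [e2, e3, ← Complex.ofReal_mul, Complex.re_mul_ofReal, Complex.exp_ofReal_mul_I_re]
  ring

lemma integrable_mehlerKernel_left {t : ℝ} (ht : 0 < t) (y : EuclideanSpace ℝ (Fin d)) :
    Integrable (fun x => mehlerKernel t x y) (gaussMeasure d) := by
  have hs := one_sub_exp_neg_two_mul_pos ht
  rw [integrable_gaussMeasure_iff]
  simp only [smul_eq_mul, gaussDensity_mul_mehlerKernel ht]
  exact ((integrable_exp_neg_mul_norm_sq (inv_pos.mpr hs)).comp_sub_right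
    (Real.exp (-t) • y)).const_mul _

/-- The action of the Mehler kernel on trigonometric functions. -/
lemma integral_mehlerKernel_mul_trigFun {t : ℝ} (ht : 0 < t) (ξ : EuclideanSpace ℝ (Fin d))
    (a : ℝ) (y : EuclideanSpace ℝ (Fin d)) :
    ∫ x, mehlerKernel t x y * trigFun ξ a x ∂(gaussMeasure d)
      = Real.exp (-(1 - Real.exp (-2 * t)) * ‖ξ‖ ^ 2 / 4) * trigFun (Real.exp (-t) • ξ) a y := by
  have hs := one_sub_exp_neg_two_mul_pos ht
  rw [integral_gaussMeasure]
  simp only [smul_eq_mul, ← mul_assoc, gaussDensity_mul_mehlerKernel ht]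
  simp only [mul_assoc]
  rw [integral_const_mul]
  rw [← integral_add_right_eq_self _ (Real.exp (-t) • y)]
  have e : ∀ x, trigFun ξ a (x + Real.exp (-t) • y)
      = trigFun ξ (Real.exp (-t) * inner ℝ ξ y + a) x := by
    intro x
    simp only [trigFun, inner_add_right, real_inner_smul_right, add_assoc]
  simp only [add_sub_cancel_right, e]
  rw [integral_exp_neg_mul_norm_sq_mul_cos (inv_pos.mpr hs), trigFun, real_inner_smul_left,
    ← mul_assoc, ← mul_assoc, div_inv_eq_mul, neg_div, Real.rpow_neg (by positivity),
    inv_mul_cancel₀ (by positivity), one_mul]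
  congr 2
  field_simp

lemma integral_mehlerKernel_left {t : ℝ} (ht : 0 < t) (y : EuclideanSpace ℝ (Fin d)) :
    ∫ x, mehlerKernel t x y ∂(gaussMeasure d) = 1 := by
  simpa [trigFun] using integral_mehlerKernel_mul_trigFun ht 0 0 y

lemma lintegral_mehlerKernel_left {t : ℝ} (ht : 0 < t) (y : EuclideanSpace ℝ (Fin d)) :
    ∫⁻ x, ENNReal.ofReal (mehlerKernel t x y) ∂(gaussMeasure d) = 1 := by
  rw [← ofReal_integral_eq_lintegral_ofReal (integrable_mehlerKernel_left ht y)
    (Eventually.of_forall fun x => mehlerKernel_nonneg t ht x y), integral_mehlerKernel_left ht,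
    ENNReal.ofReal_one]

end MehlerKernel

/-! ### Real functions as vectors of `L²(γ)`, and density of the trigonometric span. -/

section RealElements

variable {d : ℕ} (𝕜 : Type*) [RCLike 𝕜]

/-- A real square integrable function as an element of `L²(γ)` over `𝕜`. -/
noncomputable def realLp {φ : EuclideanSpace ℝ (Fin d) → ℝ} (hφ : MemLp φ 2 (gaussMeasure d)) :
    GaussL2 𝕜 d :=
  (hφ.ofReal (K := 𝕜)).toLp

variable {𝕜}

lemma realLp_coeFn {φ : EuclideanSpace ℝ (Fin d) → ℝ} (hφ : MemLp φ 2 (gaussMeasure d)) :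
    realLp 𝕜 hφ =ᵐ[gaussMeasure d] fun x => (φ x : 𝕜) :=
  MemLp.coeFn_toLp (hφ.ofReal (K := 𝕜))

lemma inner_realLp {φ : EuclideanSpace ℝ (Fin d) → ℝ} (hφ : MemLp φ 2 (gaussMeasure d))
    (u : GaussL2 𝕜 d) : inner 𝕜 (realLp 𝕜 hφ) u = ∫ x, φ x • u x ∂(gaussMeasure d) := by
  rw [L2.inner_def]
  refine integral_congr_ae ?_
  filter_upwards [realLp_coeFn (𝕜 := 𝕜) hφ] with x hx
  rw [hx, RCLike.inner_apply, RCLike.conj_ofReal, RCLike.real_smul_eq_coe_mul, mul_comm]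

lemma memLp_trigFun (ξ : EuclideanSpace ℝ (Fin d)) (a : ℝ) :
    MemLp (trigFun ξ a) 2 (gaussMeasure d) :=
  MemLp.of_bound (trigFun_continuous ξ a).aestronglyMeasurable 1
    (Eventually.of_forall fun x => abs_trigFun_le ξ a x)

lemma GaussL2.integrable (u : GaussL2 𝕜 d) : Integrable u (gaussMeasure d) :=
  (Lp.memLp u).integrable (by norm_num)

lemma GaussL2.ext_trigFun {u v : GaussL2 𝕜 d}
    (h : ∀ ξ a, ∫ x, trigFun ξ a x • u x ∂(gaussMeasure d)
      = ∫ x, trigFun ξ a x • v x ∂(gaussMeasure d)) : u = v := by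
  have := ae_eq_zero_of_integral_trigFun_smul_eq_zero (u.integrable.sub v.integrable)
    fun ξ a => by
      simp only [Pi.sub_apply, smul_sub]
      rw [integral_sub (integrable_trigFun_smul u.integrable ξ a)
        (integrable_trigFun_smul v.integrable ξ a), h, sub_self]
  refine Lp.ext ?_
  filter_upwards [this] with x hx
  exact sub_eq_zero.mp hx

lemma GaussL2.dense_span_trigFun : Dense (Submodule.span 𝕜
    (Set.range fun p : EuclideanSpace ℝ (Fin d) × ℝ => realLp 𝕜 (memLp_trigFun p.1 p.2)) :
      Set (GaussL2 𝕜 d)) := by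
  rw [Submodule.dense_iff_topologicalClosure_eq_top, Submodule.topologicalClosure_eq_top_iff,
    Submodule.eq_bot_iff]
  intro u hu
  refine GaussL2.ext_trigFun fun ξ a => ?_
  rw [← inner_realLp (memLp_trigFun ξ a), ← inner_realLp (memLp_trigFun ξ a), inner_zero_right]
  exact (Submodule.mem_orthogonal _ _).mp hu _ (Submodule.subset_span ⟨(ξ, a), rfl⟩)

end RealElements

/-! ### The Mehler operators form a contractive `C₀`-semigroup. -/

section MehlerSemigroup

variable (𝕜 : Type*) [RCLike 𝕜] (d : ℕ)

open scoped Classical in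
/-- The Mehler semigroup on `L²(γ)`. -/
noncomputable def mehlerSemigroup (t : ℝ≥0) : GaussL2 𝕜 d →L[𝕜] GaussL2 𝕜 d :=
  if ht : 0 < (t : ℝ) then
    (kernelOperator 𝕜 (memLp_mehlerKernel (d := d) ht)).mkContinuous 1 fun u => by
      rw [one_mul]
      exact norm_kernelOperator_le _ (continuous_mehlerKernel t).measurable
        (mehlerKernel_nonneg t ht)
        (fun x => by
          simp only [mehlerKernel_comm ht x]
          exact (lintegral_mehlerKernel_left ht x).le)
        (fun y => (lintegral_mehlerKernel_left ht y).le) u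
  else ContinuousLinearMap.id 𝕜 _

variable {𝕜 d}

lemma mehlerSemigroup_apply {t : ℝ≥0} (ht : 0 < (t : ℝ)) (u : GaussL2 𝕜 d) :
    mehlerSemigroup 𝕜 d t u = kernelOperator 𝕜 (memLp_mehlerKernel ht) u := by
  rw [mehlerSemigroup, dif_pos ht]; rfl

lemma mehlerSemigroup_zero : mehlerSemigroup 𝕜 d 0 = ContinuousLinearMap.id 𝕜 _ := by
  rw [mehlerSemigroup, dif_neg (by simp)]

lemma norm_mehlerSemigroup_le (t : ℝ≥0) : ‖mehlerSemigroup 𝕜 d t‖ ≤ 1 := by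
  by_cases ht : 0 < (t : ℝ)
  · rw [mehlerSemigroup, dif_pos ht]
    exact LinearMap.mkContinuous_norm_le _ zero_le_one _
  · rw [mehlerSemigroup, dif_neg ht]
    exact ContinuousLinearMap.norm_id_le

lemma norm_mehlerSemigroup_apply_le (t : ℝ≥0) (u : GaussL2 𝕜 d) :
    ‖mehlerSemigroup 𝕜 d t u‖ ≤ ‖u‖ :=
  ((mehlerSemigroup 𝕜 d t).le_opNorm u).trans
    (mul_le_of_le_one_left (norm_nonneg _) (norm_mehlerSemigroup_le t))

/-- The semigroup is diagonal up to a dilation of frequencies. Together with `GaussL2.ext_trigFun`,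
this reduces identities for the operators to identities between scalar functions of `t`. -/
lemma integral_trigFun_smul_mehlerSemigroup (t : ℝ≥0) (u : GaussL2 𝕜 d)
    (ξ : EuclideanSpace ℝ (Fin d)) (a : ℝ) :
    ∫ x, trigFun ξ a x • mehlerSemigroup 𝕜 d t u x ∂(gaussMeasure d)
      = Real.exp (-(1 - Real.exp (-2 * t)) * ‖ξ‖ ^ 2 / 4) •
          ∫ x, trigFun (Real.exp (-t) • ξ) a x • u x ∂(gaussMeasure d) := by
  by_cases ht : 0 < (t : ℝ)
  · rw [mehlerSemigroup_apply ht, integral_real_smul_kernelOperator _ (memLp_trigFun ξ a),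
      ← integral_smul]
    simp only [integral_mehlerKernel_mul_trigFun ht, smul_smul]
  · have : t = 0 := by
      rw [← NNReal.coe_eq_zero]; exact le_antisymm (not_lt.mp ht) t.2
    subst this
    simp [mehlerSemigroup_zero]

/-- For a contraction `S` one has `‖S w - w‖² ≤ 2 (‖w‖² - Re ⟨w, S w⟩)`, so convergence of `⟨w, S_t
w⟩`, which is explicit here, gives norm convergence. -/
lemma tendsto_mehlerSemigroup_trigFun (ξ : EuclideanSpace ℝ (Fin d)) (a : ℝ) :
    Tendsto (fun t => mehlerSemigroup 𝕜 d t (realLp 𝕜 (memLp_trigFun ξ a))) (𝓝 0)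
      (𝓝 (realLp 𝕜 (memLp_trigFun ξ a))) := by
  set w : GaussL2 𝕜 d := realLp 𝕜 (memLp_trigFun ξ a) with hw
  have h1 : Tendsto (fun t => inner 𝕜 w (mehlerSemigroup 𝕜 d t w)) (𝓝 0) (𝓝 (inner 𝕜 w w)) := by
    have hc : Continuous fun t : ℝ≥0 => Real.exp (-(1 - Real.exp (-2 * t)) * ‖ξ‖ ^ 2 / 4) •
          ∫ x, trigFun (Real.exp (-t) • ξ) a x • w x ∂(gaussMeasure d) := by
      refine Continuous.smul (by fun_prop) ?_
      exact (continuous_integral_trigFun_smul w.integrable).comp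
        (g := fun p : EuclideanSpace ℝ (Fin d) × ℝ =>
          ∫ x, trigFun p.1 p.2 x • w x ∂(gaussMeasure d))
        (f := fun t : ℝ≥0 => (Real.exp (-t) • ξ, a)) (by fun_prop)
    have := hc.tendsto 0
    simp only [NNReal.coe_zero, mul_zero, Real.exp_zero, sub_self, neg_zero, zero_mul, zero_div,
      one_smul] at this
    rw [← inner_realLp (memLp_trigFun ξ a), ← hw] at this
    refine this.congr fun t => ?_
    rw [← integral_trigFun_smul_mehlerSemigroup, ← inner_realLp (memLp_trigFun ξ a)]
  have h2 : Tendsto (fun t => 2 * (‖w‖ ^ 2 - RCLike.re (inner 𝕜 w (mehlerSemigroup 𝕜 d t w))))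
      (𝓝 0) (𝓝 0) := by
    have := ((RCLike.continuous_re.tendsto _).comp h1).const_sub (‖w‖ ^ 2) |>.const_mul 2
    rw [inner_self_eq_norm_sq, sub_self, mul_zero] at this
    exact this
  have h3 : Tendsto (fun t => ‖mehlerSemigroup 𝕜 d t w - w‖ ^ 2) (𝓝 0) (𝓝 0) := by
    refine squeeze_zero (fun _ => by positivity) (fun t => ?_) h2
    rw [norm_sub_rev, @norm_sub_sq 𝕜]
    have := norm_mehlerSemigroup_apply_le t w
    nlinarith [norm_nonneg (mehlerSemigroup 𝕜 d t w)]
  rw [tendsto_iff_norm_sub_tendsto_zero]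
  have := (Real.continuous_sqrt.tendsto 0).comp h3
  simpa [Function.comp_def] using this

/-- On trigonometric pairings the semigroup law is `(1 - p²) + p² (1 - q²) = 1 - (pq)²` with `p =
e^{-s}`, `q = e^{-t}`. Strong continuity extends from the dense trigonometric span because the
operators are contractions. -/
lemma mehlerSemigroup_isC0Semigroup : IsC0Semigroup (mehlerSemigroup 𝕜 d) where
  map_zero := mehlerSemigroup_zero
  map_add s t := by
    refine ContinuousLinearMap.ext fun u => GaussL2.ext_trigFun fun ξ a => ?_
    rw [ContinuousLinearMap.comp_apply, integral_trigFun_smul_mehlerSemigroup,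
      integral_trigFun_smul_mehlerSemigroup, integral_trigFun_smul_mehlerSemigroup, smul_smul,
      smul_smul, ← Real.exp_add, ← Real.exp_add, norm_smul, Real.norm_of_nonneg (Real.exp_pos _).le]
    have e1 : -(t : ℝ) + -s = -((s + t : ℝ≥0) : ℝ) := by push_cast; ring
    rw [e1]
    congr 2
    rw [mul_pow, ← exp_neg_two_mul,
      show -2 * ((s + t : ℝ≥0) : ℝ) = -2 * s + -2 * t by push_cast; ring, Real.exp_add]
    ring
  tendsto_zero u := by
    rw [Metric.tendsto_nhds]
    intro ε hε
    obtain ⟨w, hw, huw⟩ := Metric.mem_closure_iff.mp (GaussL2.dense_span_trigFun u) (ε / 3)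
      (by positivity)
    have hlim : Tendsto (fun t => mehlerSemigroup 𝕜 d t w) (𝓝 0) (𝓝 w) := by
      clear huw
      induction hw using Submodule.span_induction with
      | mem v hv =>
        obtain ⟨p, rfl⟩ := hv
        exact tendsto_mehlerSemigroup_trigFun p.1 p.2
      | zero => simp
      | add v w _ _ hv hw => simpa using hv.add hw
      | smul c v _ hv => simpa using hv.const_smul c
    filter_upwards [Metric.tendsto_nhds.mp hlim (ε / 3) (by positivity)] with t ht
    have h1 : dist (mehlerSemigroup 𝕜 d t u) (mehlerSemigroup 𝕜 d t w) ≤ dist u w := by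
      rw [dist_eq_norm, dist_eq_norm, ← map_sub]
      exact norm_mehlerSemigroup_apply_le _ _
    calc dist (mehlerSemigroup 𝕜 d t u) u
        ≤ dist (mehlerSemigroup 𝕜 d t u) (mehlerSemigroup 𝕜 d t w)
          + dist (mehlerSemigroup 𝕜 d t w) w + dist w u := dist_triangle4 _ _ _ _
      _ < ε / 3 + ε / 3 + ε / 3 := by
        rw [dist_comm w u]
        gcongr
        exact h1.trans_lt huw
      _ = ε := by ring

end MehlerSemigroup

/-! ### The generator of the Mehler semigroup is the operator with maximal weak domain. -/

section MehlerGenerator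

variable {𝕜 : Type*} [RCLike 𝕜] {d : ℕ}

/-- The derivative in time of the Mehler semigroup acting on trigonometric functions. -/
lemma hasDerivAt_exp_mul_trigFun (ξ x : EuclideanSpace ℝ (Fin d)) (a s : ℝ) :
    HasDerivAt (fun s => Real.exp (-(1 - Real.exp (-2 * s)) * ‖ξ‖ ^ 2 / 4)
        * trigFun (Real.exp (-s) • ξ) a x)
      (Real.exp (-(1 - Real.exp (-2 * s)) * ‖ξ‖ ^ 2 / 4)
        * ouExpr (trigFun (Real.exp (-s) • ξ) a) x) s := by
  have h1 : HasDerivAt (fun s : ℝ => Real.exp (-2 * s)) (Real.exp (-2 * s) * (-2 * 1)) s :=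
    ((hasDerivAt_id s).const_mul (-2)).exp
  have h2 : HasDerivAt (fun s : ℝ => Real.exp (-s)) (Real.exp (-s) * (-1)) s :=
    (hasDerivAt_id s).neg.exp
  have h3 : HasDerivAt (fun s => Real.exp (-(1 - Real.exp (-2 * s)) * ‖ξ‖ ^ 2 / 4))
      (Real.exp (-(1 - Real.exp (-2 * s)) * ‖ξ‖ ^ 2 / 4)
        * (-(-(Real.exp (-2 * s) * (-2 * 1))) * ‖ξ‖ ^ 2 / 4)) s :=
    ((((h1.const_sub 1).neg).mul_const (‖ξ‖ ^ 2)).div_const 4).exp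
  have h4 : HasDerivAt (fun s => Real.cos (Real.exp (-s) * inner ℝ ξ x + a))
      (-Real.sin (Real.exp (-s) * inner ℝ ξ x + a) * (Real.exp (-s) * (-1) * inner ℝ ξ x)) s :=
    ((h2.mul_const (inner ℝ ξ x)).add_const a).cos
  have h5 := h3.mul h4
  rw [ouExpr_trigFun]
  simp only [trigFun, real_inner_smul_left, norm_smul, Real.norm_of_nonneg (Real.exp_pos _).le,
    mul_pow, ← exp_neg_two_mul, ← add_assoc, Real.cos_add_pi_div_two]
  refine h5.congr_deriv ?_
  ring

lemma abs_ouExpr_trigFun_le (ξ : EuclideanSpace ℝ (Fin d)) (a : ℝ)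
    (x : EuclideanSpace ℝ (Fin d)) :
    |ouExpr (trigFun ξ a) x| ≤ (1 / 2 * ‖ξ‖ ^ 2 + ‖ξ‖) * (1 + ‖x‖) := by
  rw [ouExpr_trigFun]
  have h1 : |-(1 / 2) * ‖ξ‖ ^ 2 * trigFun ξ a x| ≤ 1 / 2 * ‖ξ‖ ^ 2 := by
    rw [neg_mul, neg_mul, abs_neg, abs_mul, abs_of_nonneg (by positivity)]
    exact mul_le_of_le_one_right (by positivity) (abs_trigFun_le _ _ _)
  have h2 : |inner ℝ ξ x * trigFun ξ (a + Real.pi / 2) x| ≤ ‖ξ‖ * ‖x‖ := by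
    rw [abs_mul]
    exact (mul_le_of_le_one_right (abs_nonneg _) (abs_trigFun_le _ _ _)).trans
      (abs_real_inner_le_norm _ _)
  refine (abs_sub _ _).trans ((add_le_add h1 h2).trans ?_)
  have := norm_nonneg ξ
  have := norm_nonneg x
  have : 0 ≤ ‖ξ‖ ^ 2 * ‖x‖ := by positivity
  nlinarith

lemma hasDerivAt_integral_exp_mul_trigFun (u : GaussL2 𝕜 d) (ξ : EuclideanSpace ℝ (Fin d))
    (a s : ℝ) :
    HasDerivAt (fun s => ∫ x, (Real.exp (-(1 - Real.exp (-2 * s)) * ‖ξ‖ ^ 2 / 4)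
        * trigFun (Real.exp (-s) • ξ) a x) • u x ∂(gaussMeasure d))
      (∫ x, (Real.exp (-(1 - Real.exp (-2 * s)) * ‖ξ‖ ^ 2 / 4)
        * ouExpr (trigFun (Real.exp (-s) • ξ) a) x) • u x ∂(gaussMeasure d)) s := by
  have hcont : Continuous fun r : ℝ => Real.exp (-(1 - Real.exp (-2 * r)) * ‖ξ‖ ^ 2 / 4)
      * (1 / 2 * ‖Real.exp (-r) • ξ‖ ^ 2 + ‖Real.exp (-r) • ξ‖) := by fun_prop
  -- For times within distance 1 of `s` the differentiated integrand is dominated by `B (1 + ‖x‖) ‖u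
  -- x‖`, a product of two functions in `L²(γ)`.
  obtain ⟨B, hB⟩ := (isCompact_closedBall s 1).exists_bound_of_continuousOn hcont.continuousOn
  have hB0 : 0 ≤ B := (norm_nonneg _).trans (hB s (Metric.mem_closedBall_self zero_le_one))
  have hu := Lp.memLp u
  have h1c : MemLp (fun _ : EuclideanSpace ℝ (Fin d) => (1 : ℝ)) 2 (gaussMeasure d) :=
    memLp_const _
  have h1x : MemLp (fun x : EuclideanSpace ℝ (Fin d) => B * (1 + ‖x‖)) 2 (gaussMeasure d) :=
    (h1c.add memLp_norm_gaussMeasure).const_mul B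
  have m1 : ∀ r : ℝ, Integrable (fun x => (Real.exp (-(1 - Real.exp (-2 * r)) * ‖ξ‖ ^ 2 / 4)
      * trigFun (Real.exp (-r) • ξ) a x) • u x) (gaussMeasure d) := by
    intro r
    have := (integrable_trigFun_smul u.integrable (Real.exp (-r) • ξ) a).smul
      (Real.exp (-(1 - Real.exp (-2 * r)) * ‖ξ‖ ^ 2 / 4))
    refine this.congr (Eventually.of_forall fun x => ?_)
    simp only [Pi.smul_apply, mul_smul]
  have m2 : AEStronglyMeasurable (fun x => (Real.exp (-(1 - Real.exp (-2 * s)) * ‖ξ‖ ^ 2 / 4)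
      * ouExpr (trigFun (Real.exp (-s) • ξ) a) x) • u x) (gaussMeasure d) := by
    have hc : Continuous fun x => Real.exp (-(1 - Real.exp (-2 * s)) * ‖ξ‖ ^ 2 / 4)
        * ouExpr (trigFun (Real.exp (-s) • ξ) a) x :=
      continuous_const.mul (ouExpr_continuous (trigFun_contDiff _ _))
    exact hc.aestronglyMeasurable.smul hu.1
  refine (hasDerivAt_integral_of_dominated_loc_of_deriv_le
    (F := fun s x => (Real.exp (-(1 - Real.exp (-2 * s)) * ‖ξ‖ ^ 2 / 4)
        * trigFun (Real.exp (-s) • ξ) a x) • u x)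
    (F' := fun s x => (Real.exp (-(1 - Real.exp (-2 * s)) * ‖ξ‖ ^ 2 / 4)
        * ouExpr (trigFun (Real.exp (-s) • ξ) a) x) • u x)
    (bound := fun x => ‖(B * (1 + ‖x‖)) • u x‖) (Metric.ball_mem_nhds s one_pos)
    (Eventually.of_forall fun r => (m1 r).1) (m1 s) m2 (Eventually.of_forall fun x r hr => ?_)
    (h1x.integrable_real_smul hu).norm (Eventually.of_forall fun x r hr => ?_)).2
  · rw [norm_smul, norm_smul]
    gcongr
    refine le_trans ?_ (le_abs_self _)
    rw [norm_mul]
    calc _ ≤ ‖Real.exp (-(1 - Real.exp (-2 * r)) * ‖ξ‖ ^ 2 / 4)‖ *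
          ((1 / 2 * ‖Real.exp (-r) • ξ‖ ^ 2 + ‖Real.exp (-r) • ξ‖) * (1 + ‖x‖)) := by
          gcongr
          exact abs_ouExpr_trigFun_le _ _ _
      _ = ‖Real.exp (-(1 - Real.exp (-2 * r)) * ‖ξ‖ ^ 2 / 4)
            * (1 / 2 * ‖Real.exp (-r) • ξ‖ ^ 2 + ‖Real.exp (-r) • ξ‖)‖ * (1 + ‖x‖) := by
          rw [norm_mul, Real.norm_of_nonneg
            (by positivity : 0 ≤ 1 / 2 * ‖Real.exp (-r) • ξ‖ ^ 2 + ‖Real.exp (-r) • ξ‖), mul_assoc]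
      _ ≤ B * (1 + ‖x‖) := by
          gcongr
          exact hB r (Metric.ball_subset_closedBall hr)
  · exact (hasDerivAt_exp_mul_trigFun ξ x a r).smul_const _

/-- The Duhamel formula for elements of the weak domain. -/
lemma mehlerSemigroup_sub_eq_integral {u f : GaussL2 𝕜 d} (h : (u, f) ∈ ouGraph 𝕜 d) (t : ℝ≥0) :
    mehlerSemigroup 𝕜 d t u - u = ∫ s in (0 : ℝ)..t, mehlerSemigroup 𝕜 d s.toNNReal f := by
  have hF : Continuous fun s : ℝ => mehlerSemigroup 𝕜 d s.toNNReal f :=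
    (mehlerSemigroup_isC0Semigroup.continuous_apply f).comp continuous_real_toNNReal
  refine GaussL2.ext_trigFun fun ξ a => ?_
  rw [← inner_realLp (memLp_trigFun ξ a), ← inner_realLp (memLp_trigFun ξ a), inner_sub_right]
  set w : GaussL2 𝕜 d := realLp 𝕜 (memLp_trigFun ξ a) with hw
  have h1 := (innerSL 𝕜 w).intervalIntegral_comp_comm (μ := volume)
    (hF.intervalIntegrable 0 t)
  simp only [innerSL_apply_apply] at h1
  rw [← h1]
  have hval : ∀ (v : GaussL2 𝕜 d) (s : ℝ), 0 ≤ s →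
      inner 𝕜 w (mehlerSemigroup 𝕜 d s.toNNReal v)
        = ∫ x, (Real.exp (-(1 - Real.exp (-2 * s)) * ‖ξ‖ ^ 2 / 4)
          * trigFun (Real.exp (-s) • ξ) a x) • v x ∂(gaussMeasure d) := by
    intro v s hs
    rw [hw, inner_realLp, integral_trigFun_smul_mehlerSemigroup, Real.coe_toNNReal s hs,
      ← integral_smul]
    simp only [smul_smul]
  -- Differentiation in time puts `L` on the trigonometric function; the weak equation, tested with
  -- that function, moves it to `u` and produces `f`.
  have hder : ∀ s ∈ Set.uIcc (0 : ℝ) t, HasDerivAt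
      (fun s => ∫ x, (Real.exp (-(1 - Real.exp (-2 * s)) * ‖ξ‖ ^ 2 / 4)
        * trigFun (Real.exp (-s) • ξ) a x) • u x ∂(gaussMeasure d))
      (inner 𝕜 w (mehlerSemigroup 𝕜 d s.toNNReal f)) s := by
    intro s hs
    rw [Set.uIcc_of_le (NNReal.coe_nonneg t)] at hs
    refine (hasDerivAt_integral_exp_mul_trigFun u ξ a s).congr_deriv ?_
    rw [hval f s hs.1]
    simp only [mul_smul]
    rw [integral_smul, integral_smul, integral_ouExpr_trigFun_smul_eq_of_mem_ouGraph h]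
  rw [intervalIntegral.integral_eq_sub_of_hasDerivAt hder
    ((continuous_const.inner hF).intervalIntegrable 0 t), ← hval u t (NNReal.coe_nonneg t), ← hval u 0 le_rfl]
  simp [mehlerSemigroup_zero]

/-- By the Duhamel formula the difference quotient is the mean over `[0, t]` of the continuous orbit
of `f`. -/
lemma tendsto_mehlerSemigroup_of_mem_ouGraph {u f : GaussL2 𝕜 d} (h : (u, f) ∈ ouGraph 𝕜 d) :
    Tendsto (fun t : ℝ≥0 => (((t : ℝ)⁻¹ : ℝ) : 𝕜) • (mehlerSemigroup 𝕜 d t u - u)) (𝓝[>] 0)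
      (𝓝 f) := by
  have hF : Continuous fun s : ℝ => mehlerSemigroup 𝕜 d s.toNNReal f :=
    (mehlerSemigroup_isC0Semigroup.continuous_apply f).comp continuous_real_toNNReal
  have hd := intervalIntegral.integral_hasDerivAt_right (hF.intervalIntegrable 0 0)
    (hF.stronglyMeasurableAtFilter _ _) hF.continuousAt
  have hs := hasDerivAt_iff_tendsto_slope.mp hd
  have hm : Tendsto (fun t : ℝ≥0 => (t : ℝ)) (𝓝[>] 0) (𝓝[≠] 0) := by
    refine tendsto_nhdsWithin_iff.mpr ⟨?_, ?_⟩
    · exact (NNReal.continuous_coe.tendsto 0).mono_left nhdsWithin_le_nhds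
    · filter_upwards [self_mem_nhdsWithin] with t ht
      exact (NNReal.coe_pos.mpr ht).ne'
  have := hs.comp hm
  rw [Real.toNNReal_zero, mehlerSemigroup_zero, ContinuousLinearMap.id_apply] at this
  refine this.congr fun t => ?_
  rw [mehlerSemigroup_sub_eq_integral h, ← RCLike.real_smul_eq_coe_smul (K := 𝕜)]
  simp [slope_def_module]

lemma memLp_of_continuous_hasCompactSupport {φ : EuclideanSpace ℝ (Fin d) → ℝ}
    (hφ : Continuous φ) (hc : HasCompactSupport φ) : MemLp φ 2 (gaussMeasure d) :=
  hφ.memLp_of_hasCompactSupport hc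

/-- Test functions belong to the domain of the Ornstein-Uhlenbeck operator. -/
lemma realLp_mem_ouGraph {φ : EuclideanSpace ℝ (Fin d) → ℝ} (hφ : ContDiff ℝ ∞ φ)
    (hc : HasCompactSupport φ) :
    (realLp 𝕜 (memLp_of_continuous_hasCompactSupport hφ.continuous hc),
      realLp 𝕜 (memLp_of_continuous_hasCompactSupport (ouExpr_continuous hφ)
        (ouExpr_hasCompactSupport hc))) ∈ ouGraph 𝕜 d := by
  intro ψ hψ hψc
  have e1 : ∀ {g h : EuclideanSpace ℝ (Fin d) → ℝ} (hh : MemLp h 2 (gaussMeasure d)),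
      ∫ x, g x • realLp 𝕜 hh x ∂(gaussMeasure d)
        = ((∫ x, g x * h x ∂(gaussMeasure d) : ℝ) : 𝕜) := by
    intro g h hh
    rw [← integral_ofReal]
    refine integral_congr_ae ?_
    filter_upwards [realLp_coeFn (𝕜 := 𝕜) hh] with x hx
    rw [hx, RCLike.real_smul_eq_coe_mul, RCLike.ofReal_mul]
  rw [e1, e1, integral_ouExpr_mul_comm (contDiff_infty.mp hψ 2) (contDiff_infty.mp hφ 2) hψc]

/-- Symmetry of the operator, inherited from the kernel. A real first argument is enough, since the
test functions are real. -/
lemma inner_mehlerSemigroup_realLp {φ : EuclideanSpace ℝ (Fin d) → ℝ}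
    (hφ : MemLp φ 2 (gaussMeasure d)) (t : ℝ≥0) (u : GaussL2 𝕜 d) :
    inner 𝕜 (mehlerSemigroup 𝕜 d t (realLp 𝕜 hφ)) u
      = inner 𝕜 (realLp 𝕜 hφ) (mehlerSemigroup 𝕜 d t u) := by
  by_cases ht : 0 < (t : ℝ)
  · have h := integral_mul_kernel (memLp_mehlerKernel (d := d) ht) (Lp.memLp u)
      (hφ.ofReal (K := 𝕜))
    rw [inner_realLp, L2.inner_def, mehlerSemigroup_apply ht, mehlerSemigroup_apply ht]
    calc _ = _ := ?_
      _ = _ := h.symm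
      _ = _ := ?_
    · refine integral_congr_ae ?_
      filter_upwards [kernelOperator_coeFn (memLp_mehlerKernel ht) (realLp 𝕜 hφ)] with y hy
      have e : ∫ x, mehlerKernel t y x • realLp 𝕜 hφ x ∂(gaussMeasure d)
          = ((∫ x, mehlerKernel t x y * φ x ∂(gaussMeasure d) : ℝ) : 𝕜) := by
        rw [← integral_ofReal]
        refine integral_congr_ae ?_
        filter_upwards [realLp_coeFn (𝕜 := 𝕜) hφ] with x hx
        rw [hx, RCLike.real_smul_eq_coe_mul, RCLike.ofReal_mul, mehlerKernel_comm ht]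
      rw [hy, RCLike.inner_apply, e, RCLike.conj_ofReal, mul_comm, ← integral_ofReal]
      simp only [RCLike.real_smul_eq_coe_mul, RCLike.ofReal_mul]
    · refine integral_congr_ae ?_
      filter_upwards [kernelOperator_coeFn (memLp_mehlerKernel ht) u] with x hx
      rw [hx, RCLike.real_smul_eq_coe_mul]
  · rw [mehlerSemigroup, dif_neg ht]; rfl

/-- The Ornstein-Uhlenbeck operator, with its maximal weak domain, generates the Mehler
semigroup. -/
lemma mehlerSemigroup_isGenerator : IsGenerator (ouOperator 𝕜 d) (mehlerSemigroup 𝕜 d) := by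
  intro u f
  rw [ouOperator_graph]
  refine ⟨tendsto_mehlerSemigroup_of_mem_ouGraph, fun h φ hφ hc => ?_⟩
  have m1 := memLp_of_continuous_hasCompactSupport hφ.continuous hc
  have m2 := memLp_of_continuous_hasCompactSupport (ouExpr_continuous hφ)
    (ouExpr_hasCompactSupport hc)
  -- For the converse, the difference quotient of `u` is paired with `φ` and the semigroup is moved
  -- to `φ` by symmetry. Since `φ` lies in the weak domain, its quotient tends to `Lφ`; comparing
  -- both limits is the weak equation.
  have h1 := tendsto_mehlerSemigroup_of_mem_ouGraph (realLp_mem_ouGraph (𝕜 := 𝕜) hφ hc)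
  have h2 := h1.inner (𝕜 := 𝕜) (tendsto_const_nhds (x := u))
  have h3 := (tendsto_const_nhds (x := realLp 𝕜 m1)).inner (𝕜 := 𝕜) h
  have := tendsto_nhds_unique h2 (h3.congr fun t => ?_)
  · rwa [inner_realLp, inner_realLp] at this
  · rw [inner_smul_left, inner_smul_right, inner_sub_left, inner_sub_right,
      inner_mehlerSemigroup_realLp, RCLike.conj_ofReal]

end MehlerGenerator

/-! ### Normal ordering in one dimension, Stirling numbers and Hermite polynomials. -/

section OneDimensional

/-- The formal adjoint `g ↦ 2xg - g'` of the derivative with respect to the Gaussian measure. -/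
noncomputable def dualDeriv (g : ℝ → ℝ) (x : ℝ) : ℝ := 2 * x * g x - deriv g x

/-- The one-dimensional Ornstein-Uhlenbeck expression. -/
noncomputable def ouExprReal (g : ℝ → ℝ) (x : ℝ) : ℝ := 1 / 2 * deriv (deriv g) x - x * deriv g x

variable {f g : ℝ → ℝ}

lemma ContDiff.deriv_infty (hf : ContDiff ℝ ∞ f) : ContDiff ℝ ∞ (deriv f) :=
  (contDiff_infty_iff_deriv.mp hf).2

lemma ContDiff.differentiable_infty (hf : ContDiff ℝ ∞ f) : Differentiable ℝ f :=
  (contDiff_infty_iff_deriv.mp hf).1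

lemma ContDiff.dualDeriv (hf : ContDiff ℝ ∞ f) : ContDiff ℝ ∞ (dualDeriv f) := by
  have := hf.deriv_infty
  unfold _root_.dualDeriv
  fun_prop

lemma ContDiff.dualDeriv_iterate (hf : ContDiff ℝ ∞ f) (m : ℕ) :
    ContDiff ℝ ∞ (_root_.dualDeriv^[m] f) := by
  induction m with
  | zero => exact hf
  | succ m ih => rw [Function.iterate_succ_apply']; exact ih.dualDeriv

lemma ContDiff.deriv_iterate_infty (hf : ContDiff ℝ ∞ f) (m : ℕ) :
    ContDiff ℝ ∞ (deriv^[m] f) := by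
  induction m with
  | zero => exact hf
  | succ m ih => rw [Function.iterate_succ_apply']; exact ih.deriv_infty

lemma ouExprReal_eq_dualDeriv (g : ℝ → ℝ) (x : ℝ) :
    ouExprReal g x = -(1 / 2) * dualDeriv (deriv g) x := by
  rw [ouExprReal, dualDeriv]; ring

lemma dualDeriv_add_const_mul (hf : Differentiable ℝ f) (hg : Differentiable ℝ g) (c : ℝ) :
    dualDeriv (fun x => f x + c * g x) = fun x => dualDeriv f x + c * dualDeriv g x := by
  funext x
  have := ((hf x).hasDerivAt.add ((hg x).hasDerivAt.const_mul c)).deriv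
  simp only [dualDeriv]
  rw [show deriv (fun x => f x + c * g x) x = _ from this]
  ring

lemma deriv_dualDeriv (hf : ContDiff ℝ ∞ f) :
    deriv (dualDeriv f) = fun x => dualDeriv (deriv f) x + 2 * f x := by
  funext x
  have h1 := (((hasDerivAt_id x).const_mul 2).mul (hf.differentiable_infty x).hasDerivAt).sub
    (hf.deriv_infty.differentiable_infty x).hasDerivAt
  refine h1.deriv.trans ?_
  simp only [dualDeriv, id]
  ring

/-- The commutation relation between the derivative and powers of its formal adjoint. -/
lemma deriv_dualDeriv_iterate (hf : ContDiff ℝ ∞ f) (m : ℕ) :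
    deriv (dualDeriv^[m + 1] f)
      = fun x => dualDeriv^[m + 1] (deriv f) x + 2 * (m + 1 : ℕ) * dualDeriv^[m] f x := by
  induction m with
  | zero => simpa using deriv_dualDeriv hf
  | succ m ih =>
    rw [Function.iterate_succ_apply', deriv_dualDeriv (hf.dualDeriv_iterate _), ih,
      dualDeriv_add_const_mul (hf.deriv_infty.dualDeriv_iterate _).differentiable_infty
        (hf.dualDeriv_iterate _).differentiable_infty]
    funext x
    rw [← Function.iterate_succ_apply' dualDeriv, ← Function.iterate_succ_apply' dualDeriv]
    push_cast
    ring

/-- In `-½ δ∂ (δ^m ∂^m)`, moving `∂` past `δ^m` leaves the commutator term `2m δ^{m-1}`; the outer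
`δ` restores the power and `-½` turns `2m` into `-m`. -/
lemma ouExprReal_dualDeriv_iterate (hf : ContDiff ℝ ∞ f) (m : ℕ) (x : ℝ) :
    ouExprReal (dualDeriv^[m] (deriv^[m] f)) x
      = -(1 / 2) * dualDeriv^[m + 1] (deriv^[m + 1] f) x
        - m * dualDeriv^[m] (deriv^[m] f) x := by
  rw [ouExprReal_eq_dualDeriv]
  cases m with
  | zero => simp
  | succ m =>
    have h := hf.deriv_iterate_infty (m + 1)
    rw [deriv_dualDeriv_iterate h, dualDeriv_add_const_mul
      (h.deriv_infty.dualDeriv_iterate _).differentiable_infty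
      (h.dualDeriv_iterate _).differentiable_infty, ← Function.iterate_succ_apply' dualDeriv,
      ← Function.iterate_succ_apply' dualDeriv, ← Function.iterate_succ_apply' deriv]
    push_cast
    ring

/-- The powers of the one-dimensional Ornstein-Uhlenbeck expression in normal ordered form. -/
noncomputable def ouPower (n : ℕ) (f : ℝ → ℝ) (x : ℝ) : ℝ :=
  ∑ m ∈ Finset.range (n + 1), (-1) ^ n * ((2 : ℝ) ^ m)⁻¹ * (Nat.stirlingSecond n m : ℝ)
    * dualDeriv^[m] (deriv^[m] f) x

lemma contDiff_ouPower (hf : ContDiff ℝ ∞ f) (n : ℕ) : ContDiff ℝ ∞ (ouPower n f) := by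
  unfold ouPower
  exact ContDiff.sum fun m _ => contDiff_const.mul ((hf.deriv_iterate_infty m).dualDeriv_iterate m)

lemma ouExprReal_sum {ι : Type*} (s : Finset ι) (c : ι → ℝ) (F : ι → ℝ → ℝ)
    (hF : ∀ i, ContDiff ℝ ∞ (F i)) (x : ℝ) :
    ouExprReal (fun x => ∑ i ∈ s, c i * F i x) x = ∑ i ∈ s, c i * ouExprReal (F i) x := by
  have h1 : ∀ G : ι → ℝ → ℝ, (∀ i, Differentiable ℝ (G i)) →
      deriv (fun x => ∑ i ∈ s, c i * G i x) = fun x => ∑ i ∈ s, c i * deriv (G i) x := by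
    intro G hG
    funext x
    have := (HasDerivAt.fun_sum (u := s) fun i _ => (hG i x).hasDerivAt.const_mul (c i)).deriv
    exact this
  rw [ouExprReal, h1 F fun i => (hF i).differentiable_infty,
    h1 _ fun i => (hF i).deriv_infty.differentiable_infty, Finset.mul_sum, Finset.mul_sum,
    ← Finset.sum_sub_distrib]
  refine Finset.sum_congr rfl fun i _ => ?_
  rw [ouExprReal]; ring

/-- The two terms of `ouExprReal_dualDeriv_iterate` match the two terms of the recurrence `S(n+1,
m+1) = (m+1) S(n, m+1) + S(n, m)`. -/
lemma ouExprReal_ouPower (hf : ContDiff ℝ ∞ f) (n : ℕ) :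
    ouExprReal (ouPower n f) = ouPower (n + 1) f := by
  funext x
  set F : ℕ → ℝ := fun m => dualDeriv^[m] (deriv^[m] f) x with hF
  have h := ouExprReal_sum (Finset.range (n + 1))
    (fun m => (-1) ^ n * ((2 : ℝ) ^ m)⁻¹ * (Nat.stirlingSecond n m : ℝ))
    (fun m => dualDeriv^[m] (deriv^[m] f))
    (fun m => (hf.deriv_iterate_infty m).dualDeriv_iterate m) x
  refine h.trans ?_
  simp only [ouExprReal_dualDeriv_iterate hf]
  change ∑ m ∈ Finset.range (n + 1), (-1) ^ n * ((2 : ℝ) ^ m)⁻¹ * (Nat.stirlingSecond n m : ℝ)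
    * (-(1 / 2) * F (m + 1) - m * F m) = ∑ m ∈ Finset.range (n + 1 + 1), (-1) ^ (n + 1)
      * ((2 : ℝ) ^ m)⁻¹ * (Nat.stirlingSecond (n + 1) m : ℝ) * F m
  -- The index shift is free at both ends: the term `m = 0` has the factor `m`, and the term `m = n
  -- + 1` has `S(n, n+1) = 0`.
  have hshift : ∑ m ∈ Finset.range (n + 1),
        ((2 : ℝ) ^ m)⁻¹ * (Nat.stirlingSecond n m : ℝ) * (m * F m)
      = ∑ m ∈ Finset.range (n + 1), ((2 : ℝ) ^ (m + 1))⁻¹ *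
        (Nat.stirlingSecond n (m + 1) : ℝ) * ((m + 1) * F (m + 1)) := by
    have h1 := Finset.sum_range_succ
      (fun m : ℕ => ((2 : ℝ) ^ m)⁻¹ * (Nat.stirlingSecond n m : ℝ) * (m * F m)) (n + 1)
    have h2 := Finset.sum_range_succ'
      (fun m : ℕ => ((2 : ℝ) ^ m)⁻¹ * (Nat.stirlingSecond n m : ℝ) * (m * F m)) (n + 1)
    rw [Nat.stirlingSecond_eq_zero_of_lt (Nat.lt_succ_self n)] at h1
    simp only [Nat.cast_zero, mul_zero, zero_mul, add_zero, Nat.cast_add, Nat.cast_one] at h1 h2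
    rw [← h1, h2]
  rw [Finset.sum_range_succ' _ (n + 1)]
  simp only [Nat.stirlingSecond_succ_succ, Nat.stirlingSecond_succ_zero, Nat.cast_zero, mul_zero,
    zero_mul, add_zero, Nat.cast_add, Nat.cast_mul, Nat.cast_one]
  calc _ = (-1) ^ (n + 1) * (∑ m ∈ Finset.range (n + 1),
          ((2 : ℝ) ^ (m + 1))⁻¹ * (Nat.stirlingSecond n m : ℝ) * F (m + 1)
        + ∑ m ∈ Finset.range (n + 1),
          ((2 : ℝ) ^ m)⁻¹ * (Nat.stirlingSecond n m : ℝ) * (m * F m)) := by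
        rw [← Finset.sum_add_distrib, Finset.mul_sum]
        refine Finset.sum_congr rfl fun m _ => ?_
        rw [pow_succ (2 : ℝ), mul_inv]
        ring
    _ = _ := by
        rw [hshift, ← Finset.sum_add_distrib, Finset.mul_sum]
        refine Finset.sum_congr rfl fun m _ => ?_
        ring

lemma contDiff_exp_neg_sq : ContDiff ℝ ∞ fun y : ℝ => Real.exp (-y ^ 2) := by fun_prop

lemma iteratedDeriv_exp_neg_sq (n : ℕ) (x : ℝ) :
    iteratedDeriv n (fun y => Real.exp (-y ^ 2)) x
      = (-1) ^ n * hermiteH n x * Real.exp (-x ^ 2) := by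
  rw [hermiteH, ← mul_assoc, ← mul_assoc, ← pow_add, Even.neg_one_pow ⟨n, rfl⟩, one_mul, mul_comm,
    ← mul_assoc, ← Real.exp_add]
  simp

/-- Conjugation by the Gaussian weight turns `∂` into `-δ`, so powers of `δ` are ordinary
derivatives of a weighted function. -/
lemma iteratedDeriv_exp_neg_sq_mul (hf : ContDiff ℝ ∞ f) (m : ℕ) :
    iteratedDeriv m (fun y => Real.exp (-y ^ 2) * f y)
      = fun x => (-1) ^ m * Real.exp (-x ^ 2) * dualDeriv^[m] f x := by
  induction m with
  | zero => simp
  | succ m ih =>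
    rw [iteratedDeriv_succ, ih]
    funext x
    have h0 : HasDerivAt (fun y : ℝ => Real.exp (-y ^ 2)) (Real.exp (-x ^ 2) * (-(2 * x))) x := by
      simpa using ((hasDerivAt_pow 2 x).neg).exp
    have h1 := (h0.const_mul ((-1) ^ m)).mul
      ((hf.dualDeriv_iterate m).differentiable_infty x).hasDerivAt
    refine h1.deriv.trans ?_
    rw [Function.iterate_succ_apply', dualDeriv]
    ring

/-- The Leibniz rule for `∂^m (e^{-x²} f)`; derivatives falling on the weight are Hermite
polynomials by the Rodrigues formula. -/
lemma dualDeriv_iterate_eq_sum (hf : ContDiff ℝ ∞ f) (m : ℕ) (x : ℝ) :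
    dualDeriv^[m] f x = ∑ l ∈ Finset.range (m + 1),
      (-1) ^ (m + l) * (m.choose l : ℝ) * hermiteH l x * iteratedDeriv (m - l) f x := by
  have h1 := congrFun (iteratedDeriv_exp_neg_sq_mul hf m) x
  have h2 := iteratedDeriv_mul (n := m) (x := x)
    ((contDiff_exp_neg_sq.of_le (by exact_mod_cast le_top)).contDiffAt)
    ((contDiff_infty.mp hf m).contDiffAt)
  have h3 : Real.exp (-x ^ 2) * dualDeriv^[m] f x
      = Real.exp (-x ^ 2) * ∑ l ∈ Finset.range (m + 1),
        (-1) ^ (m + l) * (m.choose l : ℝ) * hermiteH l x * iteratedDeriv (m - l) f x := by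
    have h4 : (-1 : ℝ) ^ m * ((-1) ^ m * Real.exp (-x ^ 2) * dualDeriv^[m] f x)
        = Real.exp (-x ^ 2) * dualDeriv^[m] f x := by
      rw [← mul_assoc, ← mul_assoc, ← pow_add, Even.neg_one_pow ⟨m, rfl⟩, one_mul]
    rw [← h4, ← h1]
    change (-1 : ℝ) ^ m * iteratedDeriv m ((fun y => Real.exp (-y ^ 2)) * f) x = _
    rw [h2, Finset.mul_sum, Finset.mul_sum]
    refine Finset.sum_congr rfl fun l _ => ?_
    rw [iteratedDeriv_exp_neg_sq, pow_add]
    ring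
  exact mul_left_cancel₀ (Real.exp_pos _).ne' h3

lemma iteratedDeriv_exp_neg_sq_affine (r b : ℝ) (k : ℕ) (x : ℝ) :
    iteratedDeriv k (fun x => Real.exp (-(r * x - b) ^ 2)) x
      = (-r) ^ k * hermiteH k (r * x - b) * Real.exp (-(r * x - b) ^ 2) := by
  have h1 := iteratedDeriv_comp_const_mul (n := k)
    (f := fun w : ℝ => Real.exp (-(w - b) ^ 2)) (by fun_prop) r
  have h2 := iteratedDeriv_comp_sub_const (n := k) (f := fun w : ℝ => Real.exp (-w ^ 2)) (s := b)
  rw [h1, h2]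
  simp only [iteratedDeriv_exp_neg_sq]
  rw [neg_pow]
  ring

/-- The powers of the Ornstein-Uhlenbeck expression applied to a Gaussian. -/
lemma ouPower_exp_neg_sq_affine (r b : ℝ) (n : ℕ) (x : ℝ) :
    ouPower n (fun x => Real.exp (-(r * x - b) ^ 2)) x
      = (∑ m ∈ Finset.range (n + 1), ∑ l ∈ Finset.range (m + 1),
          (-1 : ℝ) ^ (n + m + l) * ((2 : ℝ) ^ m)⁻¹ * (Nat.stirlingSecond n m : ℝ)
            * (Nat.choose m l : ℝ) * (-r) ^ (2 * m - l) * hermiteH l x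
            * hermiteH (2 * m - l) (r * x - b)) * Real.exp (-(r * x - b) ^ 2) := by
  have hf : ContDiff ℝ ∞ fun x => Real.exp (-(r * x - b) ^ 2) := by fun_prop
  rw [ouPower, Finset.sum_mul]
  refine Finset.sum_congr rfl fun m _ => ?_
  rw [dualDeriv_iterate_eq_sum (hf.deriv_iterate_infty m), Finset.mul_sum, Finset.sum_mul]
  refine Finset.sum_congr rfl fun l hl => ?_
  -- Needed because the total order of differentiation `(m - l) + m` equals `2m - l` in
  -- natural-number subtraction only for `l ≤ m`.
  have hl' : l ≤ m := Nat.lt_succ_iff.mp (Finset.mem_range.mp hl)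
  rw [← iteratedDeriv_eq_iterate, iteratedDeriv_eq_iterate, iteratedDeriv_eq_iterate,
    ← Function.iterate_add_apply, ← iteratedDeriv_eq_iterate, iteratedDeriv_exp_neg_sq_affine,
    show m - l + m = 2 * m - l by omega, add_assoc n, pow_add _ n]
  ring

/-- By the recurrence `H_{n+1} = 2x H_n - H_n'`. Only continuity and polynomial growth are drawn
from it. -/
lemma exists_polynomial_hermiteH (n : ℕ) : ∃ P : Polynomial ℝ, ∀ x, hermiteH n x = P.eval x := by
  induction n with
  | zero =>
    refine ⟨1, fun x => ?_⟩
    simp [hermiteH, ← Real.exp_add]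
  | succ n ih =>
    obtain ⟨P, hP⟩ := ih
    refine ⟨2 * Polynomial.X * P - Polynomial.derivative P, fun x => ?_⟩
    have e : iteratedDeriv n (fun y => Real.exp (-y ^ 2))
        = fun x => (-1) ^ n * P.eval x * Real.exp (-x ^ 2) := by
      funext y; rw [iteratedDeriv_exp_neg_sq, hP]
    have h0 : HasDerivAt (fun y : ℝ => Real.exp (-y ^ 2)) (Real.exp (-x ^ 2) * (-(2 * x))) x := by
      simpa using ((hasDerivAt_pow 2 x).neg).exp
    have h1 := ((P.hasDerivAt x).const_mul ((-1) ^ n)).mul h0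
    have h2 := iteratedDeriv_exp_neg_sq (n + 1) x
    rw [iteratedDeriv_succ, e] at h2
    have h3 := h2.symm.trans h1.deriv
    have h4 : Real.exp (-x ^ 2) * ((-1) ^ (n + 1) * hermiteH (n + 1) x)
        = Real.exp (-x ^ 2) * ((-1) ^ (n + 1) * (2 * x * P.eval x
          - (Polynomial.derivative P).eval x)) := by
      rw [mul_comm, h3]; ring
    have h5 := mul_left_cancel₀ (pow_ne_zero (n + 1) (by norm_num : (-1 : ℝ) ≠ 0))
      (mul_left_cancel₀ (Real.exp_pos (-x ^ 2)).ne' h4)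
    simpa using h5

lemma continuous_hermiteH (n : ℕ) : Continuous (hermiteH n) := by
  obtain ⟨P, hP⟩ := exists_polynomial_hermiteH n
  rw [funext hP]
  exact P.continuous

end OneDimensional

/-! ### The operator on tensor products and the multinomial theorem. -/

section ProductFunctions

variable {d : ℕ}

lemma ouExpr_const_mul {φ : EuclideanSpace ℝ (Fin d) → ℝ} (hφ : ContDiff ℝ 2 φ) (c : ℝ)
    (x : EuclideanSpace ℝ (Fin d)) : ouExpr (fun x => c * φ x) x = c * ouExpr φ x := by
  have d1 := fun i => (hφ.partialDeriv (m := 1) (by norm_num) i).differentiable (by norm_num)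
  rw [ouExpr_eq_sum (contDiff_const.mul hφ), ouExpr_eq_sum hφ, Finset.mul_sum]
  refine Finset.sum_congr rfl fun i _ => ?_
  rw [partialDeriv_const_mul (hφ.differentiable (by norm_num)), partialDeriv_const_mul (d1 i)]
  ring

lemma ouExpr_add {φ ψ : EuclideanSpace ℝ (Fin d) → ℝ} (hφ : ContDiff ℝ 2 φ)
    (hψ : ContDiff ℝ 2 ψ) (x : EuclideanSpace ℝ (Fin d)) :
    ouExpr (fun x => φ x + ψ x) x = ouExpr φ x + ouExpr ψ x := by
  have h1 := hφ.contDiffAt.laplacian_add (hψ.contDiffAt (x := x))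
  have h2 : gradient (fun x => φ x + ψ x) x = gradient φ x + gradient ψ x := by
    simp only [gradient]
    rw [← map_add, ← fderiv_add (hφ.differentiable (by norm_num) x)
      (hψ.differentiable (by norm_num) x)]
    rfl
  simp only [ouExpr]
  rw [h2, show Laplacian.laplacian (fun x => φ x + ψ x) x = _ from h1, inner_add_right]
  ring

lemma prod_update_apply (h : Fin d → ℝ → ℝ) (i : Fin d) (k : ℝ → ℝ) (x : Fin d → ℝ) :
    ∏ j, Function.update h i k j (x j) = k (x i) * ∏ j ∈ Finset.univ.erase i, h j (x j) := by
  rw [← Finset.mul_prod_erase Finset.univ _ (Finset.mem_univ i), Function.update_self]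
  congr 1
  refine Finset.prod_congr rfl fun j hj => ?_
  rw [Function.update_of_ne (Finset.ne_of_mem_erase hj)]

lemma partialDeriv_prod {h : Fin d → ℝ → ℝ} (hh : ∀ j, Differentiable ℝ (h j)) (i : Fin d) :
    partialDeriv i (fun x : EuclideanSpace ℝ (Fin d) => ∏ j, h j (x j))
      = fun x => ∏ j, Function.update h i (deriv (h i)) j (x j) := by
  funext x
  have h1 : ∀ j ∈ Finset.univ, HasFDerivAt (fun x : EuclideanSpace ℝ (Fin d) => h j (x j))
      (deriv (h j) (x j) • (EuclideanSpace.proj j : EuclideanSpace ℝ (Fin d) →L[ℝ] ℝ)) x :=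
    fun j _ => (hh j (x j)).hasDerivAt.comp_hasFDerivAt x
      (EuclideanSpace.proj j : EuclideanSpace ℝ (Fin d) →L[ℝ] ℝ).hasFDerivAt
  have h2 := HasFDerivAt.finsetProd h1
  rw [h2.partialDeriv i, prod_update_apply]
  simp only [sum_apply, smul_apply, smul_eq_mul]
  rw [Finset.sum_eq_single i]
  · simp [mul_comm]
  · intro j _ hj
    simp [hj]
  · simp

lemma contDiff_prod_apply {h : Fin d → ℝ → ℝ} (hh : ∀ j, ContDiff ℝ ∞ (h j)) :
    ContDiff ℝ ∞ fun x : EuclideanSpace ℝ (Fin d) => ∏ j, h j (x j) :=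
  contDiff_prod fun j _ => (hh j).comp
    (EuclideanSpace.proj j : EuclideanSpace ℝ (Fin d) →L[ℝ] ℝ).contDiff

lemma ouExpr_prod {h : Fin d → ℝ → ℝ} (hh : ∀ j, ContDiff ℝ ∞ (h j))
    (x : EuclideanSpace ℝ (Fin d)) :
    ouExpr (fun x => ∏ j, h j (x j)) x
      = ∑ i, ∏ j, Function.update h i (ouExprReal (h i)) j (x j) := by
  rw [ouExpr_eq_sum (contDiff_infty.mp (contDiff_prod_apply hh) 2)]
  refine Finset.sum_congr rfl fun i _ => ?_
  have hd : ∀ j, Differentiable ℝ (Function.update h i (deriv (h i)) j) := by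
    intro j
    rcases eq_or_ne j i with rfl | hj
    · rw [Function.update_self]; exact (hh j).deriv_infty.differentiable_infty
    · rw [Function.update_of_ne hj]; exact (hh j).differentiable_infty
  rw [partialDeriv_prod (fun j => (hh j).differentiable_infty) i, partialDeriv_prod hd i]
  simp only [Function.update_self, Function.update_idem]
  rw [prod_update_apply, prod_update_apply, prod_update_apply, ouExprReal]
  ring

/-- The linear functional on polynomials sending the monomial `X^n` to `∏ j, g j (n j) (x j)`. -/
noncomputable def tensorEval (g : Fin d → ℕ → ℝ → ℝ) (x : EuclideanSpace ℝ (Fin d)) :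
    MvPolynomial (Fin d) ℝ →ₗ[ℝ] ℝ :=
  (MvPolynomial.basisMonomials (Fin d) ℝ).constr ℝ fun n => ∏ j, g j (n j) (x j)

lemma tensorEval_monomial (g : Fin d → ℕ → ℝ → ℝ) (x : EuclideanSpace ℝ (Fin d))
    (n : Fin d →₀ ℕ) (c : ℝ) :
    tensorEval g x (MvPolynomial.monomial n c) = c * ∏ j, g j (n j) (x j) := by
  have h := (MvPolynomial.basisMonomials (Fin d) ℝ).constr_basis ℝ
    (fun n => ∏ j, g j (n j) (x j)) n
  rw [MvPolynomial.coe_basisMonomials] at h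
  have e : MvPolynomial.monomial n c = c • MvPolynomial.monomial n (1 : ℝ) := by
    rw [MvPolynomial.smul_monomial, smul_eq_mul, mul_one]
  rw [e, map_smul, smul_eq_mul, tensorEval, h]

lemma contDiff_tensorEval {g : Fin d → ℕ → ℝ → ℝ} (hg : ∀ j n, ContDiff ℝ ∞ (g j n))
    (p : MvPolynomial (Fin d) ℝ) : ContDiff ℝ ∞ fun x => tensorEval g x p := by
  induction p using MvPolynomial.induction_on' with
  | monomial n c =>
    simp only [tensorEval_monomial]
    exact contDiff_const.mul (contDiff_prod_apply fun j => hg j (n j))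
  | add p q hp hq => simp only [map_add]; exact hp.add hq

/-- Applying `L` raises one index at a time and sums over the coordinates, which on monomials is
multiplication by `∑ Xᵢ`. Iterating `L` therefore amounts to a power of `∑ Xᵢ`, expanded in
`tensorEval_sum_X_pow`. -/
lemma ouExpr_tensorEval {g : Fin d → ℕ → ℝ → ℝ} (hg : ∀ j n, ContDiff ℝ ∞ (g j n))
    (hL : ∀ j n, ouExprReal (g j n) = g j (n + 1)) (p : MvPolynomial (Fin d) ℝ)
    (x : EuclideanSpace ℝ (Fin d)) :
    ouExpr (fun x => tensorEval g x p) x = tensorEval g x (p * ∑ i, MvPolynomial.X i) := by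
  induction p using MvPolynomial.induction_on' with
  | monomial n c =>
    simp only [tensorEval_monomial]
    rw [ouExpr_const_mul (contDiff_infty.mp (contDiff_prod_apply fun j => hg j (n j)) 2),
      ouExpr_prod fun j => hg j (n j), Finset.mul_sum, Finset.mul_sum, map_sum]
    refine Finset.sum_congr rfl fun i _ => ?_
    rw [MvPolynomial.X, MvPolynomial.monomial_mul, mul_one, tensorEval_monomial]
    congr 1
    refine Finset.prod_congr rfl fun j _ => ?_
    rcases eq_or_ne j i with rfl | hj
    · simp [hL]
    · simp [hj]
  | add p q hp hq =>
    simp only [map_add, add_mul]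
    rw [ouExpr_add (contDiff_infty.mp (contDiff_tensorEval hg p) 2)
      (contDiff_infty.mp (contDiff_tensorEval hg q) 2), hp, hq]

lemma tensorEval_sum_X_pow (g : Fin d → ℕ → ℝ → ℝ) (x : EuclideanSpace ℝ (Fin d)) (N : ℕ) :
    tensorEval g x ((∑ i, MvPolynomial.X i) ^ N)
      = ∑ n ∈ Finset.piAntidiag (Finset.univ : Finset (Fin d)) N,
        (Nat.multinomial Finset.univ n : ℝ) * ∏ j, g j (n j) (x j) := by
  rw [Finset.sum_pow_eq_sum_piAntidiag, map_sum]
  refine Finset.sum_congr rfl fun n _ => ?_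
  have e : (Nat.multinomial Finset.univ n : MvPolynomial (Fin d) ℝ)
        * ∏ i, (MvPolynomial.X i : MvPolynomial (Fin d) ℝ) ^ n i
      = MvPolynomial.monomial (Finsupp.equivFunOnFinite.symm n)
        (Nat.multinomial Finset.univ n : ℝ) := by
    rw [MvPolynomial.monomial_eq, Finsupp.prod_fintype _ _ (by simp)]
    simp
  rw [e, tensorEval_monomial]
  rfl

end ProductFunctions

/-! ### The closed-form kernel and its recursion in `N`. -/

section ClosedFormKernel

variable {d : ℕ}

/-- The one-dimensional Gaussian factor of the Mehler kernel. -/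
noncomputable def gaussFactor (t b w : ℝ) : ℝ :=
  Real.exp (-(Real.exp (-t) / Real.sqrt (1 - Real.exp (-2 * t)) * w
    - b / Real.sqrt (1 - Real.exp (-2 * t))) ^ 2)

lemma contDiff_gaussFactor (t b : ℝ) : ContDiff ℝ ∞ (gaussFactor t b) := by
  unfold gaussFactor; fun_prop

/-- For fixed `y` the Mehler kernel is a constant times a product over the coordinates of shifted
Gaussians, and the inner double sums are the powers of the one-dimensional operator on these
factors. -/
lemma ouKernel_eq_tensorEval {t : ℝ} (ht : 0 < t) (N : ℕ) (x y : EuclideanSpace ℝ (Fin d)) :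
    ouKernel N t x y = ((1 - Real.exp (-2 * t)) ^ ((d : ℝ) / 2))⁻¹ * Real.exp (‖y‖ ^ 2)
      * tensorEval (fun j n => ouPower n (gaussFactor t (y j))) x
        ((∑ i, MvPolynomial.X i) ^ N) := by
  have hs := one_sub_exp_neg_two_mul_pos ht
  have hz : ∀ a b : ℝ, Real.exp (-t) / Real.sqrt (1 - Real.exp (-2 * t)) * a
      - b / Real.sqrt (1 - Real.exp (-2 * t))
      = (a * Real.exp (-t) - b) / Real.sqrt (1 - Real.exp (-2 * t)) := by
    intro a b; ring
  have hexp : Real.exp (-(‖Real.exp (-t) • x - y‖ ^ 2 / (1 - Real.exp (-2 * t))))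
      = ∏ j, Real.exp (-((x j * Real.exp (-t) - y j)
        / Real.sqrt (1 - Real.exp (-2 * t))) ^ 2) := by
    rw [← Real.exp_sum, EuclideanSpace.norm_sq_eq, Finset.sum_div, ← Finset.sum_neg_distrib]
    congr 1
    refine Finset.sum_congr rfl fun j _ => ?_
    rw [div_pow, Real.sq_sqrt hs.le]
    simp [mul_comm]
  rw [ouKernel, mehlerKernel, hexp, tensorEval_sum_X_pow, Finset.mul_sum, Finset.mul_sum]
  refine Finset.sum_congr rfl fun n _ => ?_
  have hp : ∀ j, ouPower (n j) (gaussFactor t (y j)) (x j) = _ := fun j =>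
    ouPower_exp_neg_sq_affine _ _ _ _
  simp only [hp, hz, Finset.prod_mul_distrib]
  rw [div_eq_mul_inv]
  ring

lemma contDiff_ouKernel {t : ℝ} (ht : 0 < t) (N : ℕ) (y : EuclideanSpace ℝ (Fin d)) :
    ContDiff ℝ ∞ fun x => ouKernel N t x y := by
  simp only [ouKernel_eq_tensorEval ht]
  exact contDiff_const.mul (contDiff_tensorEval
    (fun j n => contDiff_ouPower (contDiff_gaussFactor t (y j)) n) _)

/-- The kernels satisfy the recursion `L_x M_t^N = M_t^{N+1}`. -/
lemma ouExpr_ouKernel {t : ℝ} (ht : 0 < t) (N : ℕ) (x y : EuclideanSpace ℝ (Fin d)) :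
    ouExpr (fun x => ouKernel N t x y) x = ouKernel (N + 1) t x y := by
  have hg : ∀ (j : Fin d) n, ContDiff ℝ ∞ (ouPower n (gaussFactor t (y j))) := fun j n =>
    contDiff_ouPower (contDiff_gaussFactor t (y j)) n
  simp only [ouKernel_eq_tensorEval ht]
  rw [ouExpr_const_mul (contDiff_infty.mp (contDiff_tensorEval hg _) 2), ouExpr_tensorEval hg
    fun j n => ouExprReal_ouPower (contDiff_gaussFactor t (y j)) n, pow_succ (∑ i, MvPolynomial.X i)]

lemma ouKernel_zero (t : ℝ) (x y : EuclideanSpace ℝ (Fin d)) :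
    ouKernel 0 t x y = mehlerKernel t x y := by
  have h : ∀ w, hermiteH 0 w = 1 := fun w => by simp [hermiteH, ← Real.exp_add]
  simp [ouKernel, h, Nat.multinomial]

lemma continuous_ouKernel (N : ℕ) (t : ℝ) :
    Continuous (Function.uncurry (ouKernel N t) :
      EuclideanSpace ℝ (Fin d) × EuclideanSpace ℝ (Fin d) → ℝ) := by
  have h1 := continuous_mehlerKernel (d := d) t
  have h2 := continuous_hermiteH
  unfold ouKernel Function.uncurry
  refine h1.mul ?_
  fun_prop

end ClosedFormKernel

/-! ### Square integrability of the closed-form kernels. -/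

section SlowGrowth

variable {V : Type*} [NormedAddCommGroup V]

/-- Functions growing more slowly than every Gaussian `exp (ε ‖x‖²)`. -/
def HasSlowGrowth (f : V → ℝ) : Prop :=
  ∀ ε > 0, ∃ C, ∀ x, |f x| ≤ C * Real.exp (ε * ‖x‖ ^ 2)

namespace HasSlowGrowth

lemma const (c : ℝ) : HasSlowGrowth fun _ : V => c := fun ε hε =>
  ⟨|c|, fun x => le_mul_of_one_le_right (abs_nonneg _) (Real.one_le_exp (by positivity))⟩

lemma add {f g : V → ℝ} (hf : HasSlowGrowth f) (hg : HasSlowGrowth g) :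
    HasSlowGrowth fun x => f x + g x := by
  intro ε hε
  obtain ⟨C, hC⟩ := hf ε hε
  obtain ⟨D, hD⟩ := hg ε hε
  exact ⟨C + D, fun x => (abs_add_le _ _).trans ((add_le_add (hC x) (hD x)).trans_eq (by ring))⟩

lemma mul {f g : V → ℝ} (hf : HasSlowGrowth f) (hg : HasSlowGrowth g) :
    HasSlowGrowth fun x => f x * g x := by
  intro ε hε
  obtain ⟨C, hC⟩ := hf (ε / 2) (by positivity)
  obtain ⟨D, hD⟩ := hg (ε / 2) (by positivity)
  refine ⟨C * D, fun x => ?_⟩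
  rw [abs_mul]
  refine (mul_le_mul (hC x) (hD x) (abs_nonneg _) ((abs_nonneg _).trans (hC x))).trans_eq ?_
  rw [mul_mul_mul_comm, ← Real.exp_add]
  ring_nf

lemma sum {ι : Type*} {s : Finset ι} {f : ι → V → ℝ} (hf : ∀ i ∈ s, HasSlowGrowth (f i)) :
    HasSlowGrowth fun x => ∑ i ∈ s, f i x := by
  induction s using Finset.cons_induction with
  | empty => simpa using const 0
  | cons a s ha ih =>
    simp only [Finset.sum_cons]
    exact (hf a (by simp)).add (ih fun i hi => hf i (by simp [hi]))

lemma prod {ι : Type*} {s : Finset ι} {f : ι → V → ℝ} (hf : ∀ i ∈ s, HasSlowGrowth (f i)) :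
    HasSlowGrowth fun x => ∏ i ∈ s, f i x := by
  induction s using Finset.cons_induction with
  | empty => simpa using const 1
  | cons a s ha ih =>
    simp only [Finset.prod_cons]
    exact (hf a (by simp)).mul (ih fun i hi => hf i (by simp [hi]))

lemma polynomial {f : V → ℝ} (hf : HasSlowGrowth f) (P : Polynomial ℝ) :
    HasSlowGrowth fun x => P.eval (f x) := by
  induction P using Polynomial.induction_on' with
  | add p q hp hq => simp only [Polynomial.eval_add]; exact hp.add hq
  | monomial n a =>
    simp only [Polynomial.eval_monomial]
    refine (const a).mul ?_
    induction n with
    | zero => simpa using const 1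
    | succ n ih => simp only [pow_succ]; exact ih.mul hf

lemma of_abs_le_norm {f : V → ℝ} (hf : ∀ x, |f x| ≤ ‖x‖) : HasSlowGrowth f := by
  intro ε hε
  refine ⟨1 + ε⁻¹, fun x => (hf x).trans ?_⟩
  have h1 : ‖x‖ ≤ 1 + ‖x‖ ^ 2 := by nlinarith [sq_nonneg (‖x‖ - 1), sq_nonneg ‖x‖]
  have h2 : 1 + ‖x‖ ^ 2 ≤ (1 + ε⁻¹) * (ε * ‖x‖ ^ 2 + 1) := by
    have : (1 + ε⁻¹) * (ε * ‖x‖ ^ 2 + 1) = 1 + ‖x‖ ^ 2 + (ε * ‖x‖ ^ 2 + ε⁻¹) := by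
      field_simp; ring
    rw [this]
    have : 0 ≤ ε * ‖x‖ ^ 2 + ε⁻¹ := by positivity
    linarith
  refine h1.trans (h2.trans ?_)
  gcongr
  exact Real.add_one_le_exp _

lemma hermiteH {f : V → ℝ} (hf : HasSlowGrowth f) (n : ℕ) :
    HasSlowGrowth fun x => hermiteH n (f x) := by
  obtain ⟨P, hP⟩ := exists_polynomial_hermiteH n
  simp only [hP]
  exact hf.polynomial P

end HasSlowGrowth

variable {d : ℕ}

/-- The factor multiplying the Mehler kernel is a polynomial, so it costs an arbitrarily small
Gaussian exponent, while the Mehler kernel stays strictly below the threshold 1/2. -/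
lemma memLp_ouKernel {t : ℝ} (ht : 0 < t) (N : ℕ) :
    MemLp (Function.uncurry (ouKernel N t)) 2 ((gaussMeasure d).prod (gaussMeasure d)) := by
  have hx : ∀ i : Fin d, HasSlowGrowth
      fun p : EuclideanSpace ℝ (Fin d) × EuclideanSpace ℝ (Fin d) => p.1 i := fun i =>
    .of_abs_le_norm fun p => (PiLp.norm_apply_le p.1 i).trans (norm_fst_le p)
  have hy : ∀ i : Fin d, HasSlowGrowth
      fun p : EuclideanSpace ℝ (Fin d) × EuclideanSpace ℝ (Fin d) => p.2 i := fun i =>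
    .of_abs_le_norm fun p => (PiLp.norm_apply_le p.2 i).trans (norm_snd_le p)
  have hz : ∀ i : Fin d, HasSlowGrowth
      fun p : EuclideanSpace ℝ (Fin d) × EuclideanSpace ℝ (Fin d) =>
        (p.1 i * Real.exp (-t) - p.2 i) / Real.sqrt (1 - Real.exp (-2 * t)) := by
    intro i
    have := (((hx i).mul (.const (Real.exp (-t)))).add ((hy i).mul (.const (-1)))).mul
      (.const (Real.sqrt (1 - Real.exp (-2 * t)))⁻¹)
    simpa only [mul_neg, mul_one, ← sub_eq_add_neg, ← div_eq_mul_inv] using this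
  have hQ : HasSlowGrowth fun p : EuclideanSpace ℝ (Fin d) × EuclideanSpace ℝ (Fin d) =>
      ∑ n ∈ Finset.piAntidiag (Finset.univ : Finset (Fin d)) N,
        (Nat.multinomial Finset.univ n : ℝ) *
          ∏ i, ∑ m ∈ Finset.range (n i + 1), ∑ l ∈ Finset.range (m + 1),
            (-1 : ℝ) ^ (n i + m + l) * ((2 : ℝ) ^ m)⁻¹ *
              (Nat.stirlingSecond (n i) m : ℝ) * (Nat.choose m l : ℝ) *
              (-(Real.exp (-t) / Real.sqrt (1 - Real.exp (-2 * t)))) ^ (2 * m - l) *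
              hermiteH l (p.1 i) * hermiteH (2 * m - l)
                ((p.1 i * Real.exp (-t) - p.2 i) / Real.sqrt (1 - Real.exp (-2 * t))) :=
    .sum fun n _ => (HasSlowGrowth.const _).mul <| .prod fun i _ => .sum fun m _ => .sum fun l _ =>
      ((HasSlowGrowth.const _).mul ((hx i).hermiteH l)).mul ((hz i).hermiteH _)
  have hc := exp_neg_div_one_add_lt ht
  set c := Real.exp (-t) / (1 + Real.exp (-t)) with hcdef
  -- Half of the gap between the Mehler exponent `c` and 1/2.
  obtain ⟨C, hC⟩ := hQ ((1 / 2 - c) / 2) (by linarith)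
  refine memLp_two_prod_gaussMeasure (continuous_ouKernel N t)
    (C := ((1 - Real.exp (-2 * t)) ^ ((d : ℝ) / 2))⁻¹ * C) (c := c + (1 / 2 - c) / 2)
    (by linarith) fun x y => ?_
  rw [ouKernel, abs_mul]
  have h1 := mehlerKernel_le ht x y
  have h2 := hC (x, y)
  have h3 : ‖(x, y)‖ ^ 2 ≤ ‖x‖ ^ 2 + ‖y‖ ^ 2 := by
    rw [Prod.norm_def]
    rcases max_choice ‖x‖ ‖y‖ with h | h <;> simp only [h] <;> nlinarith [sq_nonneg ‖x‖, sq_nonneg ‖y‖]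
  have hC0 : 0 ≤ C := by
    have := (abs_nonneg _).trans (hC 0)
    simpa using this
  have h4 : C * Real.exp ((1 / 2 - c) / 2 * ‖(x, y)‖ ^ 2)
      ≤ C * Real.exp ((1 / 2 - c) / 2 * (‖x‖ ^ 2 + ‖y‖ ^ 2)) := by
    have : 0 ≤ (1 / 2 - c) / 2 := by linarith
    gcongr
  refine (mul_le_mul h1 (h2.trans h4) (abs_nonneg _) ((abs_nonneg _).trans h1)).trans_eq ?_
  rw [← hcdef, mul_mul_mul_comm, ← Real.exp_add]
  ring_nf

end SlowGrowth

/-! ### Identification of the semigroup, kernel of its images under powers of `L`, and uniqueness.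
-/

section MainTheorem

variable {𝕜 : Type*} [RCLike 𝕜] {d : ℕ}

/-- By Fubini the weak equation reduces to one for `ouKernel N t · y` at each `y`. There `L` is
moved from `φ` to the kernel, which is smooth in `x`, and the recursion in `N` applies. -/
lemma kernelOperator_ouKernel_mem_ouGraph {t : ℝ} (ht : 0 < t) (N : ℕ) (u : GaussL2 𝕜 d) :
    (kernelOperator 𝕜 (memLp_ouKernel ht N) u, kernelOperator 𝕜 (memLp_ouKernel ht (N + 1)) u)
      ∈ ouGraph 𝕜 d := by
  intro φ hφ hc
  rw [integral_real_smul_kernelOperator _ (memLp_of_continuous_hasCompactSupport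
      (ouExpr_continuous hφ) (ouExpr_hasCompactSupport hc)),
    integral_real_smul_kernelOperator _ (memLp_of_continuous_hasCompactSupport hφ.continuous hc)]
  congr 1
  funext y
  congr 1
  have h := integral_ouExpr_mul_comm (contDiff_infty.mp hφ 2)
    (contDiff_infty.mp (contDiff_ouKernel ht N y) 2) hc
  simp only [mul_comm (ouKernel _ _ _ _)]
  rw [h]
  simp only [ouExpr_ouKernel ht]

lemma mehlerSemigroup_eq_kernelOperator_ouKernel {t : ℝ≥0} (ht : 0 < (t : ℝ))
    (u : GaussL2 𝕜 d) :
    mehlerSemigroup 𝕜 d t u = kernelOperator 𝕜 (memLp_ouKernel ht 0) u := by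
  rw [mehlerSemigroup_apply ht]
  refine Lp.ext ?_
  filter_upwards [kernelOperator_coeFn (memLp_ouKernel ht 0) u,
    kernelOperator_coeFn (memLp_mehlerKernel ht) u] with x h1 h2
  simp only [h1, h2, ouKernel_zero]

lemma operatorPowEq_mehlerSemigroup {t : ℝ≥0} (ht : 0 < (t : ℝ)) (N : ℕ) (u : GaussL2 𝕜 d) :
    OperatorPowEq (ouOperator 𝕜 d) N (mehlerSemigroup 𝕜 d t u)
      (kernelOperator 𝕜 (memLp_ouKernel ht N) u) := by
  induction N with
  | zero => exact (mehlerSemigroup_eq_kernelOperator_ouKernel ht u).symm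
  | succ N ih =>
    refine ⟨_, ih, ?_⟩
    rw [ouOperator_graph]
    exact kernelOperator_ouKernel_mem_ouGraph ht N u

/-- The semigroup is smoothing: `S_t u` lies in the domain for every `t > 0`, and it tends to `u`.
-/
lemma dense_domain_ouOperator :
    Dense {u : GaussL2 𝕜 d | ∃ f, (u, f) ∈ (ouOperator 𝕜 d).graph} := by
  intro u
  refine mem_closure_of_tendsto ((mehlerSemigroup_isC0Semigroup.tendsto_zero u).mono_left
    (nhdsWithin_le_nhds (s := Set.Ioi 0))) ?_
  filter_upwards [self_mem_nhdsWithin] with t ht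
  have ht' : 0 < (t : ℝ) := NNReal.coe_pos.mpr ht
  refine ⟨kernelOperator 𝕜 (memLp_ouKernel ht' 1) u, ?_⟩
  rw [ouOperator_graph, mehlerSemigroup_eq_kernelOperator_ouKernel ht']
  exact kernelOperator_ouKernel_mem_ouGraph ht' 0 u

/-- The semigroup generated by the Ornstein-Uhlenbeck operator is the Mehler semigroup. -/
lemma expSemigroup_ouOperator : expSemigroup (ouOperator 𝕜 d) = mehlerSemigroup 𝕜 d := by
  have h : ∃ S : ℝ≥0 → GaussL2 𝕜 d →L[𝕜] GaussL2 𝕜 d,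
      IsC0Semigroup S ∧ IsGenerator (ouOperator 𝕜 d) S :=
    ⟨_, mehlerSemigroup_isC0Semigroup, mehlerSemigroup_isGenerator⟩
  rw [expSemigroup, dif_pos h]
  -- The definition picks an arbitrary semigroup with this generator, of which no norm bound is
  -- known; uniqueness requires contractivity of the Mehler semigroup only.
  exact h.choose_spec.1.eq_of_isGenerator mehlerSemigroup_isC0Semigroup norm_mehlerSemigroup_le
    h.choose_spec.2 mehlerSemigroup_isGenerator dense_domain_ouOperator

lemma OperatorPowEq.unique {H : Type*} [NormedAddCommGroup H] [NormedSpace 𝕜 H]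
    {A : H →ₗ.[𝕜] H} {N : ℕ} {u f g : H} (hf : OperatorPowEq A N u f)
    (hg : OperatorPowEq A N u g) : f = g := by
  induction N generalizing f g with
  | zero => exact hf.trans hg.symm
  | succ N ih =>
    obtain ⟨v, hv, hvf⟩ := hf
    obtain ⟨w, hw, hwg⟩ := hg
    exact A.mem_graph_snd_inj hvf hwg (ih hv hw)

/-- A kernel is determined almost everywhere by its integrals against the trigonometric
functions. -/
lemma ae_eq_of_integral_mul_trigFun_eq
    {K K' : EuclideanSpace ℝ (Fin d) → EuclideanSpace ℝ (Fin d) → 𝕜}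
    {μ ν : Measure (EuclideanSpace ℝ (Fin d))} [SFinite μ] [SFinite ν]
    (hK : AEStronglyMeasurable (Function.uncurry K) (μ.prod ν))
    (hK' : AEStronglyMeasurable (Function.uncurry K') (μ.prod ν))
    (hi : ∀ᵐ x ∂μ, Integrable (K x) ν) (hi' : ∀ᵐ x ∂μ, Integrable (K' x) ν)
    (h : ∀ ξ a, ∀ᵐ x ∂μ, ∫ y, trigFun ξ a y • K x y ∂ν = ∫ y, trigFun ξ a y • K' x y ∂ν) :
    ∀ᵐ p ∂(μ.prod ν), K p.1 p.2 = K' p.1 p.2 := by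
  -- The exceptional null set in `h` depends on `(ξ, a)`. A countable dense family yields a common
  -- null set, and continuity in `(ξ, a)` recovers all parameters.
  have hdense : ∀ᵐ x ∂μ, ∀ n : ℕ,
      ∫ y, trigFun (TopologicalSpace.denseSeq (EuclideanSpace ℝ (Fin d) × ℝ) n).1
          (TopologicalSpace.denseSeq (EuclideanSpace ℝ (Fin d) × ℝ) n).2 y • K x y ∂ν
        = ∫ y, trigFun (TopologicalSpace.denseSeq (EuclideanSpace ℝ (Fin d) × ℝ) n).1
          (TopologicalSpace.denseSeq (EuclideanSpace ℝ (Fin d) × ℝ) n).2 y • K' x y ∂ν :=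
    ae_all_iff.mpr fun n => h _ _
  have hae : ∀ᵐ x ∂μ, ∀ᵐ y ∂ν, K x y = K' x y := by
    filter_upwards [hdense, hi, hi'] with x hx h1 h2
    have hext := (continuous_integral_trigFun_smul h1).ext_on
      (TopologicalSpace.denseRange_denseSeq (EuclideanSpace ℝ (Fin d) × ℝ))
      (continuous_integral_trigFun_smul h2) (by rintro _ ⟨n, rfl⟩; exact hx n)
    have := ae_eq_zero_of_integral_trigFun_smul_eq_zero (h1.sub h2) fun ξ a => by
      simp only [Pi.sub_apply, smul_sub]
      rw [integral_sub (integrable_trigFun_smul h1 ξ a) (integrable_trigFun_smul h2 ξ a),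
        sub_eq_zero]
      exact congrFun hext (ξ, a)
    filter_upwards [this] with y hy
    exact sub_eq_zero.mp hy
  -- Passing from almost all sections to the product measure needs a measurable set, hence the
  -- measurable representatives.
  have hm : MeasurableSet {p | hK.mk _ p = hK'.mk _ p} :=
    hK.stronglyMeasurable_mk.measurableSet_eq_fun hK'.stronglyMeasurable_mk
  have hmk : ∀ᵐ p ∂(μ.prod ν), hK.mk _ p = hK'.mk _ p := by
    refine (Measure.ae_prod_iff_ae_ae hm).mpr ?_
    filter_upwards [Measure.ae_ae_of_ae_prod hK.ae_eq_mk, Measure.ae_ae_of_ae_prod hK'.ae_eq_mk,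
      hae] with x h1 h2 h3
    filter_upwards [h1, h2, h3] with y e1 e2 e3
    exact e1.symm.trans (e3.trans e2)
  filter_upwards [hK.ae_eq_mk, hK'.ae_eq_mk, hmk] with p e1 e2 e3
  exact e1.trans (e3.trans e2.symm)

/-- Two integral kernels of the same single-valued relation coincide almost everywhere. -/
lemma IsIntegralKernel.ae_eq {R : GaussL2 𝕜 d → GaussL2 𝕜 d → Prop}
    (hR : ∀ u f g, R u f → R u g → f = g)
    {K K' : EuclideanSpace ℝ (Fin d) → EuclideanSpace ℝ (Fin d) → 𝕜}
    (hK : IsIntegralKernel R K) (hK' : IsIntegralKernel R K') :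
    ∀ᵐ p ∂((gaussMeasure d).prod (gaussMeasure d)), K p.1 p.2 = K' p.1 p.2 := by
  have key : ∀ {K : EuclideanSpace ℝ (Fin d) → EuclideanSpace ℝ (Fin d) → 𝕜} {f : GaussL2 𝕜 d}
      (ξ : EuclideanSpace ℝ (Fin d)) (a : ℝ), (∀ᵐ x ∂(gaussMeasure d),
      Integrable (fun y => K x y * realLp 𝕜 (memLp_trigFun ξ a) y) (gaussMeasure d) ∧
      f x = ∫ y, K x y * realLp 𝕜 (memLp_trigFun ξ a) y ∂(gaussMeasure d)) →
      ∀ᵐ x ∂(gaussMeasure d), Integrable (fun y => trigFun ξ a y • K x y) (gaussMeasure d) ∧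
        f x = ∫ y, trigFun ξ a y • K x y ∂(gaussMeasure d) := by
    intro K f ξ a hx
    filter_upwards [hx] with x hx
    have e : (fun y => K x y * realLp 𝕜 (memLp_trigFun ξ a) y)
        =ᵐ[gaussMeasure d] fun y => trigFun ξ a y • K x y := by
      filter_upwards [realLp_coeFn (𝕜 := 𝕜) (memLp_trigFun ξ a)] with y hy
      rw [hy, RCLike.real_smul_eq_coe_mul, mul_comm]
    exact ⟨hx.1.congr e, hx.2.trans (integral_congr_ae e)⟩
  have hint : ∀ {K : EuclideanSpace ℝ (Fin d) → EuclideanSpace ℝ (Fin d) → 𝕜},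
      IsIntegralKernel R K → ∀ᵐ x ∂(gaussMeasure d), Integrable (K x) (gaussMeasure d) := by
    intro K hK
    -- The choice `ξ = 0`, `a = 0` is the constant function 1, so absolute convergence says that `K
    -- x` itself is integrable.
    obtain ⟨f, -, hf⟩ := hK.2 (realLp 𝕜 (memLp_trigFun 0 0))
    filter_upwards [key 0 0 hf] with x hx
    simpa [trigFun] using hx.1
  refine ae_eq_of_integral_mul_trigFun_eq hK.1 hK'.1 (hint hK) (hint hK') fun ξ a => ?_
  obtain ⟨f, hRf, hf⟩ := hK.2 (realLp 𝕜 (memLp_trigFun ξ a))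
  obtain ⟨g, hRg, hg⟩ := hK'.2 (realLp 𝕜 (memLp_trigFun ξ a))
  obtain rfl := hR _ _ _ hRf hRg
  filter_upwards [key ξ a hf, key ξ a hg] with x h1 h2
  exact h1.2.symm.trans h2.2

end MainTheorem

theorem mainTheorem1 (𝕜 : Type*) [RCLike 𝕜] (d N : ℕ) (t : ℝ≥0) (ht : 0 < t) :
    IsIntegralKernel
        (fun u f : GaussL2 𝕜 d =>
          OperatorPowEq (ouOperator 𝕜 d) N (expSemigroup (ouOperator 𝕜 d) t u) f)
        (fun x y => (ouKernel N (t : ℝ) x y : 𝕜)) ∧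
      ∀ K : EuclideanSpace ℝ (Fin d) → EuclideanSpace ℝ (Fin d) → 𝕜,
        IsIntegralKernel
            (fun u f : GaussL2 𝕜 d =>
              OperatorPowEq (ouOperator 𝕜 d) N (expSemigroup (ouOperator 𝕜 d) t u) f) K →
          ∀ᵐ p ∂((gaussMeasure d).prod (gaussMeasure d)),
            K p.1 p.2 = (ouKernel N (t : ℝ) p.1 p.2 : 𝕜) := by
  have ht' : 0 < (t : ℝ) := NNReal.coe_pos.mpr ht
  have hker : IsIntegralKernel
      (fun u f : GaussL2 𝕜 d =>
        OperatorPowEq (ouOperator 𝕜 d) N (expSemigroup (ouOperator 𝕜 d) t u) f)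
      (fun x y => (ouKernel N (t : ℝ) x y : 𝕜)) := by
    refine ⟨(RCLike.continuous_ofReal.comp (continuous_ouKernel N t)).aestronglyMeasurable,
      fun u => ⟨kernelOperator 𝕜 (memLp_ouKernel ht' N) u, ?_, ?_⟩⟩
    · rw [expSemigroup_ouOperator]
      exact operatorPowEq_mehlerSemigroup ht' N u
    · filter_upwards [kernelOperator_coeFn (memLp_ouKernel ht' N) u,
        (memLp_ouKernel ht' N).kernel_ae_integrable (Lp.memLp u)] with x h1 h2
      simp only [RCLike.real_smul_eq_coe_mul] at h1 h2
      exact ⟨h2, h1⟩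
  exact ⟨hker, fun K hK => hK.ae_eq (fun _ _ _ hf hg => hf.unique hg) hker⟩
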